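/- Fix a finite set $\mathfrak L$ of types and $d\in\mathbb N$. A typed forest $F$ is a finite rooted forest with nodes $N_F$, edges $E_F$ oriented away from the roots, and a map $E_F\to\mathfrak L$. A coloured forest $(F,\hat F)$ is a typed forest with a map $\hat F\colon N_F\sqcup E_F\to\mathbb N$ such that $\hat F(e)\ne0$ for $e=(x,y)\in E_F$ implies $\hat F(x)=\hat F(y)=\hat F(e)$; for $k>0$, $\hat F_k=\hat F^{-1}(k)$ is then a subforest of $F$. For a subforest $A$ of $F$ (a set $N_A$ of nodes and a set $E_A$ of edges between them), $\hat F\!\upharpoonright\! A$ is the restriction of $\hat F$ to $A$, and $\hat F\cup_k A$ equals $k$ on $A$ and $\hat F$ elsewhere. Decorated forests are isomorphism classes of $(F,\hat F,\mathfrak n,\mathfrak o,\mathfrak e)$ with $(F,\hat F)$ a coloured forest, $\mathfrak n\colon N_F\to\mathbb N^d$, $\mathfrak o\colon N_F\to\mathbb Z^d\oplus\mathbb Z(\mathfrak L)$ (where $\mathbb Z(\mathfrak L)$ is the free abelian group on $\mathfrak L$) supported on nodes of non-zero colour, and $\mathfrak e\colon E_F\to\mathbb N^d$ supported on edges of colour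 $0$; they form a set $\mathfrak F$ with the disjoint union $\cdot$ as product. Its bigrading is $|(F,\hat F,\mathfrak n,\mathfrak o,\mathfrak e)|_{\rm bi}=\big(\sum_e|\mathfrak e(e)|,\ \#\{\text{edges and non-root nodes of colour }0\}\big)$, and $\langle\mathfrak F\rangle$ is the space of formal series $\sum_{n\in\mathbb N^2}v_n$ with $v_n$ a finite real linear combination of decorated forests of bidegree $n$ and, for some $k$, $v_n=0$ whenever $n_2>k$; $\hat\otimes$ is the corresponding completed tensor product, consisting of formal series in the total bidegree with the same condition. Let $0<i<j$. For $k\in\{i,j\}$, suppose we are given for each coloured forest $(F,\hat F)$ a collection $\mathfrak A_k(F,\hat F)$ of subforests of $F$, compatible with isomorphisms of coloured forests, such that every $A\in\mathfrak A_k(F,\hat F)$ satisfies: $\hat F_k\subset A$; $\hat F_l\cap A=\emptyset$ for all $l>k$; and, for $0<l<k$, every connected component of $\hat F_l$ is either contained in $A$ or disjoint from $A$. Suppose moreover that for every coloured forest $(F,\hat F)$ and all subforests $A,B$ of $F$, $$A\in\mathfrak A_i(F,\hat F)\ \text{ and }\ B\in\mathfrak A_j(F,\hat F\cup_iA)$$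 holds if and only if $$B\in\mathfrak A_j(F,\hat F)\ \text{ and }\ A=A_2\sqcup A_1\ \text{ for some }A_2\in\mathfrak A_i(F,\hat F\cup_jB),\ A_1\in\mathfrak A_i(B,\hat F\!\upharpoonright\! B).$$ For $k\in\{i,j\}$ let $\Delta_k\colon\langle\mathfrak F\rangle\to\langle\mathfrak F\rangle\mathbin{\hat\otimes}\langle\mathfrak F\rangle$ be the triangular linear map given on decorated forests $\tau=(F,\hat F,\mathfrak n,\mathfrak o,\mathfrak e)$ by $$\Delta_k\tau=\sum_{A\in\mathfrak A_k(F,\hat F)}\ \sum_{\varepsilon,\mathfrak n_A}\frac1{\varepsilon!}\binom{\mathfrak n}{\mathfrak n_A}\,(A,\hat F\!\upharpoonright\! A,\mathfrak n_A+\pi\varepsilon,\mathfrak o\!\upharpoonright\! N_A,\mathfrak e\!\upharpoonright\! E_A)\otimes(F,\hat F\cup_kA,\mathfrak n-\mathfrak n_A,\mathfrak o+\mathfrak n_A+\pi(\varepsilon-\mathfrak e\mathbf 1_{E_A}),\mathfrak e\mathbf 1_{E_F\setminus E_A}+\varepsilon),$$ where $\mathfrak n_A$ runs over all maps $N_F\to\mathbb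 N^d$ supported on $N_A$, $\varepsilon$ over all maps $E_F\to\mathbb N^d$ supported on the edges $(x,y)\in E_F\setminus E_A$ with $x\in N_A$, and $\pi f(x)=\sum_{e=(x,y)\in E_F}f(e)$; factorials and binomial coefficients are products over nodes or edges and over coordinates, and $\binom{a}{b}=0$ unless $0\le b\le a$. Then $$\mathcal M^{(13)(2)(4)}(\Delta_i\otimes\Delta_i)\Delta_j=(\mathrm{id}\otimes\Delta_j)\Delta_i$$ on $\langle\mathfrak F\rangle$ (in particular on decorated forests), where $\mathcal M^{(13)(2)(4)}(\tau_1\otimes\tau_2\otimes\tau_3\otimes\tau_4)=(\tau_1\cdot\tau_3)\otimes\tau_2\otimes\tau_4$. -/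

import Mathlib

/-! ### Bigraded spaces and triangular maps -/

/-- A set whose elements carry a bidegree in `ℕ²`. -/
class Bigraded (X : Type*) where
  bideg : X → ℕ × ℕ

open Bigraded (bideg)

/-- The basis `x ⊗ y` of a tensor product is graded by the sum of the bidegrees. -/
instance {X Y : Type*} [Bigraded X] [Bigraded Y] : Bigraded (X × Y) :=
  ⟨fun p => bideg p.1 + bideg p.2⟩

/-- The partial order on `ℕ²`: `TriLE n m` says `m ≥ n`, i.e. `m₁ ≥ n₁` and `m₂ ≤ n₂`. -/
def TriLE (n m : ℕ × ℕ) : Prop := n.1 ≤ m.1 ∧ m.2 ≤ n.2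

/-- The bigraded space `⟨X⟩` generated by a bigraded set `X`: formal sums `∑ₙ vₙ` over `n ∈ ℕ²`,
where `vₙ` is a (finite) linear combination of elements of bidegree `n` and where, for some `k`,
`vₙ = 0` as soon as `n₂ > k`. A formal sum is given by its coefficients.

The space `Vec(Xₘ) ⊗ Vec(Yₗ)` is the free vector space on the symbols `x ⊗ y`, that is on
`Xₘ × Yₗ`. The completed tensor product `⟨X⟩ ⊗̂ ⟨Y⟩`, which consists of the formal sums over
`n ∈ ℕ²` of elements of `⨁_{m+l=n} Vec(Xₘ) ⊗ Vec(Yₗ)` with the same vanishing condition,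
is therefore `⟨X × Y⟩`. -/
def Ser (X : Type*) [Bigraded X] : Submodule ℝ (X → ℝ) where
  carrier := {f | (∀ n, {x | bideg x = n ∧ f x ≠ 0}.Finite) ∧
    ∃ k, ∀ x, f x ≠ 0 → (bideg x).2 ≤ k}
  zero_mem' := ⟨fun n => by simp, 0, fun x h => absurd rfl h⟩
  add_mem' := by
    rintro f g ⟨hf, k, hk⟩ ⟨hg, l, hl⟩
    refine ⟨fun n => ((hf n).union (hg n)).subset ?_, max k l, fun x hx => ?_⟩
    · rintro x ⟨h1, h2⟩
      by_cases h : f x = 0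
      · right; exact ⟨h1, fun h' => h2 (by simp [h, h'])⟩
      · left; exact ⟨h1, h⟩
    · by_cases h : f x = 0
      · exact le_max_of_le_right (hl x fun h' => hx (by simp [h, h']))
      · exact le_max_of_le_left (hk x h)
  smul_mem' := by
    rintro a f ⟨hf, k, hk⟩
    refine ⟨fun n => (hf n).subset ?_, k, fun x hx => hk x fun h => hx (by simp [h])⟩
    rintro x ⟨h1, h2⟩
    exact ⟨h1, fun h => h2 (by simp [h])⟩

/-- A triangular family of linear maps `Vec(Xₙ) → Vec(Yₘ)`, given by its matrix:
`coeff x y` is the coefficient of `y` in the image of `x`. -/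
@[ext]
structure Tri (X Y : Type*) [Bigraded X] [Bigraded Y] where
  coeff : X → Y → ℝ
  finite : ∀ x m, {y | bideg y = m ∧ coeff x y ≠ 0}.Finite
  tri : ∀ x y, coeff x y ≠ 0 → TriLE (bideg x) (bideg y)

namespace Tri

variable {X Y X' Y' : Type*} [Bigraded X] [Bigraded Y] [Bigraded X'] [Bigraded Y']

theorem finite_low (f : Ser X) (m : ℕ) : {x | (bideg x).1 ≤ m ∧ f.1 x ≠ 0}.Finite := by
  obtain ⟨hf, k, hk⟩ := f.2
  refine ((Set.finite_Icc (0 : ℕ × ℕ) (m, k)).biUnion fun n _ => hf n).subset ?_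
  rintro x ⟨h1, h2⟩
  simp only [Set.mem_iUnion]
  exact ⟨bideg x, ⟨⟨Nat.zero_le _, Nat.zero_le _⟩, ⟨h1, hk x h2⟩⟩, rfl, h2⟩

theorem finite_sum (T : Tri X Y) (f : Ser X) (y : Y) :
    (Function.support fun x => f.1 x * T.coeff x y).Finite := by
  refine (finite_low f (bideg y).1).subset fun x hx => ?_
  have h := mul_ne_zero_iff.1 hx
  exact ⟨(T.tri x y h.2).1, h.1⟩

theorem exists_of_sum_ne (T : Tri X Y) (f : Ser X) (y : Y)
    (h : ∑ᶠ x, f.1 x * T.coeff x y ≠ 0) : ∃ x, f.1 x ≠ 0 ∧ T.coeff x y ≠ 0 := by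
  by_contra! hc
  refine h ?_
  refine finsum_eq_zero_of_forall_eq_zero fun x => ?_
  by_cases hx : f.1 x = 0
  · simp [hx]
  · simp [hc x hx]

/-- The triangular linear map `⟨X⟩ → ⟨Y⟩` of a triangular family: the coefficient of `y` in the
image of `f` is the (finite) sum `∑ₓ f x * coeff x y`. -/
noncomputable def lin (T : Tri X Y) : Ser X →ₗ[ℝ] Ser Y where
  toFun f := ⟨fun y => ∑ᶠ x, f.1 x * T.coeff x y, by
    refine ⟨fun m => ?_, ?_⟩
    · refine ((finite_low f m.1).biUnion fun x _ => T.finite x m).subset ?_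
      rintro y ⟨rfl, h⟩
      obtain ⟨x, h1, h2⟩ := exists_of_sum_ne T f y h
      simp only [Set.mem_iUnion]
      exact ⟨x, ⟨(T.tri x y h2).1, h1⟩, rfl, h2⟩
    · obtain ⟨_, k, hk⟩ := f.2
      refine ⟨k, fun y h => ?_⟩
      obtain ⟨x, h1, h2⟩ := exists_of_sum_ne T f y h
      exact (T.tri x y h2).2.trans (hk x h1)⟩
  map_add' f g := by
    apply Subtype.ext
    funext y
    change ∑ᶠ x, (f.1 x + g.1 x) * T.coeff x y = _
    simp only [add_mul]
    exact finsum_add_distrib (finite_sum T f y) (finite_sum T g y)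
  map_smul' a f := by
    apply Subtype.ext
    funext y
    change ∑ᶠ x, (a * f.1 x) * T.coeff x y = a * ∑ᶠ x, f.1 x * T.coeff x y
    rw [mul_finsum]
    simp only [mul_assoc]

/-- The tensor product of two triangular maps: `x ⊗ x' ↦ T x ⊗ S x'`. -/
def tensor (T : Tri X Y) (S : Tri X' Y') : Tri (X × X') (Y × Y') where
  coeff p q := T.coeff p.1 q.1 * S.coeff p.2 q.2
  finite p m := by
    refine (((Set.finite_Icc 0 m).prod (Set.finite_Icc 0 m)).biUnion fun a _ =>
      (T.finite p.1 a.1).prod (S.finite p.2 a.2)).subset ?_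
    rintro q ⟨h1, h2⟩
    have h := mul_ne_zero_iff.1 h2
    simp only [Set.mem_iUnion]
    have h0 : ∀ n : ℕ × ℕ, 0 ≤ n := fun n => ⟨Nat.zero_le _, Nat.zero_le _⟩
    have h1 : bideg q.1 + bideg q.2 = m := h1
    refine ⟨(bideg q.1, bideg q.2), ⟨⟨h0 _, ?_⟩, h0 _, ?_⟩, ⟨rfl, h.1⟩, rfl, h.2⟩
    · exact h1 ▸ ⟨Nat.le_add_right _ _, Nat.le_add_right _ _⟩
    · exact h1 ▸ ⟨Nat.le_add_left _ _, Nat.le_add_left _ _⟩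
  tri p q hpq := by
    have h := mul_ne_zero_iff.1 hpq
    have h1 := T.tri _ _ h.1
    have h2 := S.tri _ _ h.2
    exact ⟨add_le_add h1.1 h2.1, add_le_add h1.2 h2.2⟩

open Classical in
/-- The linear map given on basis elements by a map that preserves the bidegree. -/
noncomputable def ofMap (φ : X → Y) (hφ : ∀ x, bideg (φ x) = bideg x) : Tri X Y where
  coeff x y := if φ x = y then 1 else 0
  finite x m := (Set.finite_singleton (φ x)).subset fun y hy => by
    by_contra h
    exact hy.2 (if_neg fun h' => h h'.symm)
  tri x y h := by
    have : φ x = y := by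
      by_contra h'
      exact h (if_neg h')
    rw [← this, hφ]
    exact ⟨le_rfl, le_rfl⟩

/-- The identity. -/
noncomputable def one : Tri X X := ofMap (fun x => x) fun _ => rfl

end Tri

/-! ### Typed rooted forests -/

/-- A finite typed rooted forest with set of types `L`. The edge `e = (x → y)` is oriented away
from the root and has `src e = x` and `tgt e = y`: a finite directed graph comes in this way from
a rooted forest if and only if every node has at most one incoming edge and there is no
directed cycle. The roots are then the nodes without incoming edge. -/
structure RForest (L : Type*) where
  N : Type
  E : Type
  [fN : Fintype N]
  [fE : Fintype E]
  src : E → N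
  tgt : E → N
  tgt_inj : Function.Injective tgt
  acyclic : ∀ x, ¬ Relation.TransGen (fun u v => ∃ e, src e = u ∧ tgt e = v) x x
  typ : E → L

attribute [instance] RForest.fN RForest.fE

namespace RForest

variable {L : Type*}

/-- Roots of the connected components. -/
def IsRoot (F : RForest L) (x : F.N) : Prop := ∀ e, F.tgt e ≠ x

open Classical in
/-- `π f (x) = ∑_{e = (x,y)} f e`. -/
noncomputable def push (F : RForest L) {M : Type*} [AddCommMonoid M] (f : F.E → M) (x : F.N) : M :=
  ∑ e, if F.src e = x then f e else 0

/-- Isomorphisms of typed rooted forests. -/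
structure Iso (F G : RForest L) where
  node : F.N ≃ G.N
  edge : F.E ≃ G.E
  src_eq : ∀ e, G.src (edge e) = node (F.src e)
  tgt_eq : ∀ e, G.tgt (edge e) = node (F.tgt e)
  typ_eq : ∀ e, G.typ (edge e) = F.typ e

namespace Iso

/-- The identity isomorphism. -/
def refl (F : RForest L) : Iso F F :=
  ⟨Equiv.refl _, Equiv.refl _, fun _ => rfl, fun _ => rfl, fun _ => rfl⟩

/-- The inverse isomorphism. -/
def symm {F G : RForest L} (φ : Iso F G) : Iso G F where
  node := φ.node.symm
  edge := φ.edge.symm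
  src_eq e := by rw [Equiv.eq_symm_apply, ← φ.src_eq, Equiv.apply_symm_apply]
  tgt_eq e := by rw [Equiv.eq_symm_apply, ← φ.tgt_eq, Equiv.apply_symm_apply]
  typ_eq e := by rw [← φ.typ_eq, Equiv.apply_symm_apply]

/-- Composition of isomorphisms. -/
def trans {F G H : RForest L} (φ : Iso F G) (ψ : Iso G H) : Iso F H where
  node := φ.node.trans ψ.node
  edge := φ.edge.trans ψ.edge
  src_eq e := by simp [φ.src_eq, ψ.src_eq]
  tgt_eq e := by simp [φ.tgt_eq, ψ.tgt_eq]
  typ_eq e := by simp [φ.typ_eq, ψ.typ_eq]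

theorem push_eq {F G : RForest L} (φ : Iso F G) {M : Type*} [AddCommMonoid M]
    (f : F.E → M) (g : G.E → M) (h : ∀ e, g (φ.edge e) = f e) (x : F.N) :
    G.push g (φ.node x) = F.push f x := by
  classical
  unfold push
  rw [← Equiv.sum_comp φ.edge]
  refine Finset.sum_congr rfl fun e _ => ?_
  simp [φ.src_eq, h]

end Iso

theorem acyclic_sum {N N' E E' : Type} {s t : E → N} {s' t' : E' → N'}
    (h : ∀ x, ¬ Relation.TransGen (fun u v => ∃ e, s e = u ∧ t e = v) x x)
    (h' : ∀ x, ¬ Relation.TransGen (fun u v => ∃ e, s' e = u ∧ t' e = v) x x) (x : N ⊕ N') :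
    ¬ Relation.TransGen (fun u v => ∃ e, Sum.map s s' e = u ∧ Sum.map t t' e = v) x x := by
  have key : ∀ x y, Relation.TransGen (fun u v => ∃ e, Sum.map s s' e = u ∧ Sum.map t t' e = v)
      x y → Sum.LiftRel (Relation.TransGen (fun u v => ∃ e, s e = u ∧ t e = v))
        (Relation.TransGen (fun u v => ∃ e, s' e = u ∧ t' e = v)) x y := by
    intro x y hxy
    induction hxy with
    | single hb =>
      obtain ⟨e | e, rfl, rfl⟩ := hb
      · exact Sum.LiftRel.inl (.single ⟨e, rfl, rfl⟩)
      · exact Sum.LiftRel.inr (.single ⟨e, rfl, rfl⟩)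
    | tail _ hb ih =>
      obtain ⟨e | e, rfl, rfl⟩ := hb
      · cases ih with
        | inl ih => exact Sum.LiftRel.inl (ih.tail ⟨e, rfl, rfl⟩)
      · cases ih with
        | inr ih => exact Sum.LiftRel.inr (ih.tail ⟨e, rfl, rfl⟩)
  intro hx
  cases key x x hx with
  | inl hx => exact h _ hx
  | inr hx => exact h' _ hx

/-- The disjoint union `F ⊔ G`. -/
abbrev disjUnion (F G : RForest L) : RForest L where
  N := F.N ⊕ G.N
  E := F.E ⊕ G.E
  src := Sum.map F.src G.src
  tgt := Sum.map F.tgt G.tgt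
  tgt_inj := F.tgt_inj.sumMap G.tgt_inj
  acyclic := acyclic_sum F.acyclic G.acyclic
  typ := Sum.elim F.typ G.typ

end RForest

/-! ### Subforests -/

/-- Subforests of `F`: a set of nodes and a set of edges between these nodes. -/
@[ext]
structure Subforest {L : Type*} (F : RForest L) where
  N : Set F.N
  E : Set F.E
  src_mem : ∀ e ∈ E, F.src e ∈ N
  tgt_mem : ∀ e ∈ E, F.tgt e ∈ N

namespace Subforest

variable {L : Type*} {F G : RForest L}

instance : Finite (Subforest F) :=
  Finite.of_injective (fun A : Subforest F => (A.N, A.E)) fun A B h => by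
    have := Prod.mk.inj h
    exact Subforest.ext this.1 this.2

/-- Inclusion of subforests. -/
instance : LE (Subforest F) := ⟨fun A B => A.N ⊆ B.N ∧ A.E ⊆ B.E⟩

/-- Two subforests are disjoint if they have no node (hence no edge) in common. -/
def Disj (A B : Subforest F) : Prop := Disjoint A.N B.N

/-- The union of two subforests, written `A ⊔ B` when they are disjoint. -/
def union (A B : Subforest F) : Subforest F where
  N := A.N ∪ B.N
  E := A.E ∪ B.E
  src_mem e he := he.imp (A.src_mem e) (B.src_mem e)
  tgt_mem e he := he.imp (A.tgt_mem e) (B.tgt_mem e)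

/-- A subforest as a typed rooted forest of its own. -/
noncomputable def toForest (A : Subforest F) : RForest L where
  N := A.N
  E := A.E
  fN := Fintype.ofFinite _
  fE := Fintype.ofFinite _
  src e := ⟨F.src e.1, A.src_mem e.1 e.2⟩
  tgt e := ⟨F.tgt e.1, A.tgt_mem e.1 e.2⟩
  tgt_inj e f h := Subtype.ext (F.tgt_inj (Subtype.ext_iff.1 h))
  acyclic x h := F.acyclic x.1 (h.lift Subtype.val (by
    rintro u v ⟨e, rfl, rfl⟩
    exact ⟨e.1, rfl, rfl⟩))
  typ e := F.typ e.1

/-- A subforest of a subforest `B` of `F`, regarded as a subforest of `F`. -/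
def lift {B : Subforest F} (A : Subforest B.toForest) : Subforest F where
  N := {x | ∃ h : x ∈ B.N, (⟨x, h⟩ : B.N) ∈ A.N}
  E := {e | ∃ h : e ∈ B.E, (⟨e, h⟩ : B.E) ∈ A.E}
  src_mem e := fun ⟨h, he⟩ => ⟨B.src_mem e h, A.src_mem ⟨e, h⟩ he⟩
  tgt_mem e := fun ⟨h, he⟩ => ⟨B.tgt_mem e h, A.tgt_mem ⟨e, h⟩ he⟩

/-- The image of a subforest under a forest isomorphism. -/
def map (φ : F.Iso G) (A : Subforest F) : Subforest G where
  N := φ.node '' A.N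
  E := φ.edge '' A.E
  src_mem := by
    rintro _ ⟨e, he, rfl⟩
    exact ⟨_, A.src_mem e he, (φ.src_eq e).symm⟩
  tgt_mem := by
    rintro _ ⟨e, he, rfl⟩
    exact ⟨_, A.tgt_mem e he, (φ.tgt_eq e).symm⟩

/-- The smallest equivalence relation on nodes that contains the edges of `B`. -/
def Linked (B : Subforest F) : F.N → F.N → Prop :=
  Relation.EqvGen fun u v => ∃ e ∈ B.E, F.src e = u ∧ F.tgt e = v

/-- The connected component of the node `x` of `B`. -/
def component (B : Subforest F) (x : B.N) : Subforest F where
  N := {y | y ∈ B.N ∧ B.Linked x y}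
  E := {e | e ∈ B.E ∧ B.Linked x (F.src e)}
  src_mem e he := ⟨B.src_mem e he.1, he.2⟩
  tgt_mem e he := ⟨B.tgt_mem e he.1, he.2.trans _ _ _ (.rel _ _ ⟨e, he.1, rfl, rfl⟩)⟩

/-- The boundary `∂(A,F)`: the edges outside `A` that leave from a node of `A`. -/
def boundary (A : Subforest F) : Set F.E := {e | e ∉ A.E ∧ F.src e ∈ A.N}

@[simp] theorem mem_map_node (φ : F.Iso G) (A : Subforest F) (x : F.N) :
    φ.node x ∈ (A.map φ).N ↔ x ∈ A.N := φ.node.injective.mem_set_image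

@[simp] theorem mem_map_edge (φ : F.Iso G) (A : Subforest F) (e : F.E) :
    φ.edge e ∈ (A.map φ).E ↔ e ∈ A.E := φ.edge.injective.mem_set_image

theorem map_symm_map (φ : F.Iso G) (A : Subforest F) : (A.map φ).map φ.symm = A := by
  ext x
  · constructor
    · rintro ⟨_, ⟨y, hy, rfl⟩, rfl⟩
      simpa [RForest.Iso.symm] using hy
    · intro h
      exact ⟨_, ⟨x, h, rfl⟩, by simp [RForest.Iso.symm]⟩
  · constructor
    · rintro ⟨_, ⟨y, hy, rfl⟩, rfl⟩
      simpa [RForest.Iso.symm] using hy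
    · intro h
      exact ⟨_, ⟨x, h, rfl⟩, by simp [RForest.Iso.symm]⟩

/-- A forest isomorphism restricts to subforests. -/
noncomputable def mapIso (φ : F.Iso G) (A : Subforest F) : A.toForest.Iso (A.map φ).toForest where
  node := φ.node.image A.N
  edge := φ.edge.image A.E
  src_eq e := Subtype.ext (φ.src_eq e.1)
  tgt_eq e := Subtype.ext (φ.tgt_eq e.1)
  typ_eq e := φ.typ_eq e.1

end Subforest

/-! ### Colourings -/

/-- Colourings `F̂` of a forest `F`, as functions on nodes and edges. -/
structure Colouring {L : Type*} (F : RForest L) where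
  node : F.N → ℕ
  edge : F.E → ℕ
  compat : ∀ e, edge e ≠ 0 → node (F.src e) = edge e ∧ node (F.tgt e) = edge e

namespace Colouring

variable {L : Type*} {F : RForest L}

/-- The subforest `F̂ⱼ` of colour `j > 0`. -/
def part (c : Colouring F) (j : ℕ+) : Subforest F where
  N := {x | c.node x = j}
  E := {e | c.edge e = j}
  src_mem e (he : c.edge e = j) := by
    have := (c.compat e (he ▸ j.ne_zero)).1
    exact this.trans he
  tgt_mem e (he : c.edge e = j) := by
    have := (c.compat e (he ▸ j.ne_zero)).2
    exact this.trans he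

/-- The restriction of a colouring to a subforest. -/
def restrict (c : Colouring F) (A : Subforest F) : Colouring A.toForest where
  node x := c.node x.1
  edge e := c.edge e.1
  compat e he := c.compat e.1 he

/-- The properties that each member `A` of a family of admissible subforests for the colour `i`
has to satisfy. -/
structure Admits (c : Colouring F) (i : ℕ+) (A : Subforest F) : Prop where
  part_le : c.part i ≤ A
  disj : ∀ j : ℕ+, i < j → (c.part j).Disj A
  component : ∀ j : ℕ+, j < i → ∀ x : (c.part j).N,
    (c.part j).component x ≤ A ∨ ((c.part j).component x).Disj A

theorem Admits.mem_edge {c : Colouring F} {i : ℕ+} {A : Subforest F} (h : c.Admits i A) {e : F.E}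
    (he : c.edge e ≠ 0) (hx : F.src e ∈ A.N ∨ F.tgt e ∈ A.N) : e ∈ A.E := by
  obtain ⟨h1, h2⟩ := c.compat e he
  let j : ℕ+ := ⟨c.edge e, Nat.pos_of_ne_zero he⟩
  have hs : F.src e ∈ (c.part j).N := h1
  have ht : F.tgt e ∈ (c.part j).N := h2
  have hE : e ∈ (c.part j).E := rfl
  rcases lt_trichotomy i j with hij | hij | hij
  · exfalso
    have hd := Set.disjoint_left.1 (h.disj j hij)
    rcases hx with hx | hx
    · exact hd hs hx
    · exact hd ht hx
  · have := h.part_le.2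
    rw [hij] at this
    exact this hE
  · have hs' : F.src e ∈ ((c.part j).component ⟨_, hs⟩).N := ⟨hs, .refl _⟩
    have ht' : F.tgt e ∈ ((c.part j).component ⟨_, hs⟩).N :=
      ⟨ht, .rel _ _ ⟨e, hE, rfl, rfl⟩⟩
    rcases h.component j hij ⟨_, hs⟩ with h' | h'
    · exact h'.2 ⟨hE, .refl _⟩
    · exfalso
      have hd := Set.disjoint_left.1 h'
      rcases hx with hx | hx
      · exact hd hs' hx
      · exact hd ht' hx

open Classical in
/-- The colouring `F̂ ∪ᵢ A`, equal to `i` on `A` and to `F̂` elsewhere. -/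
noncomputable def cup (c : Colouring F) (i : ℕ+) (A : Subforest F) (h : c.Admits i A) :
    Colouring F where
  node x := if x ∈ A.N then i else c.node x
  edge e := if e ∈ A.E then i else c.edge e
  compat e he := by
    by_cases hA : e ∈ A.E
    · simp [hA, A.src_mem e hA, A.tgt_mem e hA]
    · simp only [hA, if_false] at he ⊢
      have h1 : F.src e ∉ A.N := fun hx => hA (h.mem_edge he (.inl hx))
      have h2 : F.tgt e ∉ A.N := fun hx => hA (h.mem_edge he (.inr hx))
      simpa [h1, h2] using c.compat e he

/-- The forest isomorphism `φ` maps the colouring `c` to the colouring `c'`. -/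
def Transports {G : RForest L} (c : Colouring F) (c' : Colouring G) (φ : F.Iso G) : Prop :=
  (∀ x, c'.node (φ.node x) = c.node x) ∧ ∀ e, c'.edge (φ.edge e) = c.edge e

end Colouring

/-! ### Families of admissible subforests -/

/-- For a colour `i > 0`, a collection `𝔄ᵢ(F,F̂)` of subforests of `F` for each coloured
forest `(F,F̂)` such that every `A ∈ 𝔄ᵢ(F,F̂)` contains `F̂ᵢ`, is disjoint from `F̂ⱼ` for `j > i`,
contains or is disjoint from each connected component of `F̂ⱼ` for `0 < j < i`, and such that the
collections are compatible with isomorphisms of coloured forests. -/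
structure AdmissibleFamily (L : Type*) (i : ℕ+) where
  sub : ∀ {F : RForest L}, Colouring F → Set (Subforest F)
  admits : ∀ {F : RForest L} {c : Colouring F} {A : Subforest F}, A ∈ sub c → c.Admits i A
  map_mem : ∀ {F G : RForest L} {c : Colouring F} {c' : Colouring G} (φ : F.Iso G),
    c.Transports c' φ → ∀ {A : Subforest F}, A ∈ sub c → A.map φ ∈ sub c'

/-- The compatibility of two families that yields the cointeraction property: for every coloured
forest `(F,F̂)` and all subforests `A`, `B`, one has
`A ∈ 𝔄ᵢ(F,F̂)` and `B ∈ 𝔄ⱼ(F,F̂ ∪ᵢ A)` if and only if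
`B ∈ 𝔄ⱼ(F,F̂)` and `A ∈ 𝔄ᵢ(F,F̂ ∪ⱼ B) ⊔ 𝔄ᵢ(B,F̂↾B)`.
For `i < j` the subforests `A₂` and `A₁` below are disjoint, as `A₂` does not meet `B`. -/
def AdmissibleFamily.Cointeract {L : Type*} {i j : ℕ+} (𝔄 : AdmissibleFamily L i)
    (𝔅 : AdmissibleFamily L j) : Prop :=
  ∀ (F : RForest L) (c : Colouring F) (A B : Subforest F),
    (∃ hA : A ∈ 𝔄.sub c, B ∈ 𝔅.sub (c.cup i A (𝔄.admits hA))) ↔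
    (∃ hB : B ∈ 𝔅.sub c, ∃ A₂ ∈ 𝔄.sub (c.cup j B (𝔅.admits hB)),
      ∃ A₁ ∈ 𝔄.sub (c.restrict B), A = A₂.union (Subforest.lift A₁))

/-! ### Decorated forests -/

/-- Representatives `(F, F̂, 𝔫, 𝔬, 𝔢)` of decorated forests. The free abelian group generated
by `L` is `L →₀ ℤ`. -/
structure PreDecorated (L : Type*) (d : ℕ) where
  F : RForest L
  c : Colouring F
  n : F.N → Fin d → ℕ
  o : F.N → (Fin d → ℤ) × (L →₀ ℤ)
  e : F.E → Fin d → ℕ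
  o_supp : ∀ x, o x ≠ 0 → c.node x ≠ 0
  e_supp : ∀ a, e a ≠ 0 → c.edge a = 0

namespace PreDecorated

variable {L : Type*} {d : ℕ}

/-- The forest isomorphism `φ` maps the colouring and the decorations of `τ` to those of `σ`. -/
structure IsIso (τ σ : PreDecorated L d) (φ : τ.F.Iso σ.F) : Prop where
  c : τ.c.Transports σ.c φ
  n : ∀ x, σ.n (φ.node x) = τ.n x
  o : ∀ x, σ.o (φ.node x) = τ.o x
  e : ∀ a, σ.e (φ.edge a) = τ.e a

theorem IsIso.symm {τ σ : PreDecorated L d} {φ : τ.F.Iso σ.F} (h : IsIso τ σ φ) :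
    IsIso σ τ φ.symm where
  c := ⟨fun x => by rw [← h.c.1]; simp [RForest.Iso.symm],
    fun x => by rw [← h.c.2]; simp [RForest.Iso.symm]⟩
  n x := by rw [← h.n]; simp [RForest.Iso.symm]
  o x := by rw [← h.o]; simp [RForest.Iso.symm]
  e x := by rw [← h.e]; simp [RForest.Iso.symm]

/-- Isomorphism of decorated forests. -/
instance setoid (L : Type*) (d : ℕ) : Setoid (PreDecorated L d) where
  r τ σ := ∃ φ, IsIso τ σ φ
  iseqv :=
    { refl := fun _ => ⟨RForest.Iso.refl _, ⟨fun _ => rfl, fun _ => rfl⟩,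
        fun _ => rfl, fun _ => rfl, fun _ => rfl⟩
      symm := fun ⟨_, h⟩ => ⟨_, h.symm⟩
      trans := fun ⟨φ, h⟩ ⟨ψ, h'⟩ => ⟨φ.trans ψ,
        ⟨fun x => (h'.c.1 _).trans (h.c.1 x), fun x => (h'.c.2 _).trans (h.c.2 x)⟩,
        fun x => (h'.n _).trans (h.n x), fun x => (h'.o _).trans (h.o x),
        fun x => (h'.e _).trans (h.e x)⟩ }

/-- The bigrading `(|𝔢|, |F ∖ (F̂ ∪ ρ_F)|)`: the second component is the number of nodes and edges
of colour `0` that are not roots. -/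
noncomputable def bidegree (τ : PreDecorated L d) : ℕ × ℕ :=
  (∑ a, ∑ k, τ.e a k,
    Nat.card {x // τ.c.node x = 0 ∧ ¬ τ.F.IsRoot x} + Nat.card {a // τ.c.edge a = 0})

theorem bidegree_eq {τ σ : PreDecorated L d} (h : τ ≈ σ) : τ.bidegree = σ.bidegree := by
  obtain ⟨φ, h⟩ := h
  unfold bidegree
  congr 1
  · rw [← Equiv.sum_comp φ.edge]
    simp [h.e]
  · congr 1
    · refine Nat.card_congr (φ.node.subtypeEquiv fun x => ?_)
      rw [h.c.1]
      refine and_congr_right fun _ => not_congr ?_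
      unfold RForest.IsRoot
      rw [← φ.edge.forall_congr_right]
      simp [φ.tgt_eq]
    · exact Nat.card_congr (φ.edge.subtypeEquiv fun x => by rw [h.c.2])

/-- The forest product of representatives. -/
abbrev mul (τ σ : PreDecorated L d) : PreDecorated L d where
  F := τ.F.disjUnion σ.F
  c :=
    { node := Sum.elim τ.c.node σ.c.node
      edge := Sum.elim τ.c.edge σ.c.edge
      compat := by
        rintro (e | e) he
        · exact τ.c.compat e he
        · exact σ.c.compat e he }
  n := Sum.elim τ.n σ.n
  o := Sum.elim τ.o σ.o
  e := Sum.elim τ.e σ.e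
  o_supp := by
    rintro (x | x) hx
    · exact τ.o_supp x hx
    · exact σ.o_supp x hx
  e_supp := by
    rintro (x | x) hx
    · exact τ.e_supp x hx
    · exact σ.e_supp x hx

theorem mul_congr {τ τ' σ σ' : PreDecorated L d} (h : τ ≈ τ') (h' : σ ≈ σ') :
    τ.mul σ ≈ τ'.mul σ' := by
  obtain ⟨φ, h⟩ := h
  obtain ⟨ψ, h'⟩ := h'
  refine ⟨⟨Equiv.sumCongr φ.node ψ.node, Equiv.sumCongr φ.edge ψ.edge, ?_, ?_, ?_⟩,
    ⟨?_, ?_⟩, ?_, ?_, ?_⟩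
  · rintro (e | e)
    · exact congrArg Sum.inl (φ.src_eq e)
    · exact congrArg Sum.inr (ψ.src_eq e)
  · rintro (e | e)
    · exact congrArg Sum.inl (φ.tgt_eq e)
    · exact congrArg Sum.inr (ψ.tgt_eq e)
  · rintro (e | e)
    · exact φ.typ_eq e
    · exact ψ.typ_eq e
  · rintro (e | e)
    · exact h.c.1 e
    · exact h'.c.1 e
  · rintro (e | e)
    · exact h.c.2 e
    · exact h'.c.2 e
  · rintro (e | e)
    · exact h.n e
    · exact h'.n e
  · rintro (e | e)
    · exact h.o e
    · exact h'.o e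
  · rintro (e | e)
    · exact h.e e
    · exact h'.e e

theorem card_sum {α β : Type} [Finite α] [Finite β] (p : α ⊕ β → Prop) :
    Nat.card {x // p x} = Nat.card {a // p (.inl a)} + Nat.card {b // p (.inr b)} := by
  rw [Nat.card_congr (Equiv.subtypeSum (p := p)), Nat.card_sum]

theorem bidegree_mul (τ σ : PreDecorated L d) :
    (τ.mul σ).bidegree = τ.bidegree + σ.bidegree := by
  have hl : ∀ x : τ.F.N, (τ.mul σ).F.IsRoot (Sum.inl x) ↔ τ.F.IsRoot x := fun x =>
    ⟨fun h e he => h (.inl e) (congrArg Sum.inl he), fun h e he => by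
      rcases e with e | e
      · exact h e (Sum.inl.inj he)
      · cases he⟩
  have hr : ∀ x : σ.F.N, (τ.mul σ).F.IsRoot (Sum.inr x) ↔ σ.F.IsRoot x := fun x =>
    ⟨fun h e he => h (.inr e) (congrArg Sum.inr he), fun h e he => by
      rcases e with e | e
      · cases he
      · exact h e (Sum.inr.inj he)⟩
  unfold bidegree
  refine Prod.ext ?_ ?_
  · exact Fintype.sum_sum_type _
  · have h1 := card_sum (α := τ.F.N) (β := σ.F.N)
      (fun x => (τ.mul σ).c.node x = 0 ∧ ¬ (τ.mul σ).F.IsRoot x)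
    have h2 := card_sum (α := τ.F.E) (β := σ.F.E) (fun x => (τ.mul σ).c.edge x = 0)
    simp only [hl, hr] at h1
    change Nat.card {x // (τ.mul σ).c.node x = 0 ∧ ¬ (τ.mul σ).F.IsRoot x} +
      Nat.card {a // (τ.mul σ).c.edge a = 0} = _
    refine (congrArg₂ (· + ·) h1 h2).trans ?_
    exact add_add_add_comm _ _ _ _

end PreDecorated

/-- The set `𝔉` of decorated forests. -/
def Decorated (L : Type*) (d : ℕ) := Quotient (PreDecorated.setoid L d)

namespace Decorated

variable {L : Type*} {d : ℕ}

/-- The decorated forest of a representative. -/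
def mk (τ : PreDecorated L d) : Decorated L d := Quotient.mk _ τ

noncomputable instance : Bigraded (Decorated L d) :=
  ⟨Quotient.lift PreDecorated.bidegree fun _ _ h => PreDecorated.bidegree_eq h⟩

/-- The forest product. -/
def mul : Decorated L d → Decorated L d → Decorated L d :=
  Quotient.map₂ PreDecorated.mul fun _ _ h _ _ h' => PreDecorated.mul_congr h h'

theorem bideg_mul (τ σ : Decorated L d) : bideg (τ.mul σ) = bideg τ + bideg σ :=
  Quotient.inductionOn₂ τ σ PreDecorated.bidegree_mul

end Decorated

/-! ### The coproducts -/

section Coproduct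

variable {L : Type*} {d : ℕ} {i : ℕ+}

/-- The index set of the sum defining `Δᵢ τ`: triples of `A ∈ 𝔄ᵢ(F,F̂)`, of `ε : E_F → ℕᵈ`
supported on `∂(A,F)` and of `𝔫_A : N_F → ℕᵈ` supported on `N_A`. -/
@[ext]
structure CoprodIndex (𝔄 : AdmissibleFamily L i) (τ : PreDecorated L d) where
  A : Subforest τ.F
  mem : A ∈ 𝔄.sub τ.c
  ε : τ.F.E → Fin d → ℕ
  ε_supp : ∀ a, ε a ≠ 0 → a ∈ A.boundary
  nA : τ.F.N → Fin d → ℕ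
  nA_supp : ∀ x, nA x ≠ 0 → x ∈ A.N

namespace CoprodIndex

variable {𝔄 : AdmissibleFamily L i} {τ σ : PreDecorated L d}

/-- The coefficient `(1 / ε!) * binom(𝔫, 𝔫_A)`. It vanishes unless `𝔫_A ≤ 𝔫`. -/
noncomputable def coef (t : CoprodIndex 𝔄 τ) : ℝ :=
  (1 / ∏ a, ∏ k, ((t.ε a k).factorial : ℝ)) * ∏ x, ∏ k, ((τ.n x k).choose (t.nA x k) : ℝ)

/-- `(A, F̂↾A, 𝔫_A + πε, 𝔬↾N_A, 𝔢↾E_A)`. -/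
noncomputable abbrev left (t : CoprodIndex 𝔄 τ) : PreDecorated L d where
  F := t.A.toForest
  c := τ.c.restrict t.A
  n x := t.nA x.1 + τ.F.push t.ε x.1
  o x := τ.o x.1
  e a := τ.e a.1
  o_supp x := τ.o_supp x.1
  e_supp a := τ.e_supp a.1

open Classical in
/-- The map `ε - 𝔢_∅^A` on edges, with values in `ℤᵈ`. -/
noncomputable def shift (t : CoprodIndex 𝔄 τ) (a : τ.F.E) (k : Fin d) : ℤ :=
  (t.ε a k : ℤ) - if a ∈ t.A.E then (τ.e a k : ℤ) else 0

theorem push_shift_eq_zero (t : CoprodIndex 𝔄 τ) {x : τ.F.N} (hx : x ∉ t.A.N) :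
    τ.F.push t.shift x = 0 := by
  classical
  unfold RForest.push
  refine Finset.sum_eq_zero fun a _ => ?_
  split_ifs with h
  · subst h
    have h1 : t.ε a = 0 := by
      by_contra h
      exact hx (t.ε_supp a h).2
    have h2 : a ∉ t.A.E := fun h => hx (t.A.src_mem a h)
    funext k
    simp [shift, h1, h2]
  · rfl

open Classical in
/-- `(F, F̂ ∪ᵢ A, 𝔫 - 𝔫_A, 𝔬 + 𝔫_A + π(ε - 𝔢_∅^A), 𝔢_A^F + ε)`. -/
noncomputable abbrev right (t : CoprodIndex 𝔄 τ) : PreDecorated L d where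
  F := τ.F
  c := τ.c.cup i t.A (𝔄.admits t.mem)
  n x := τ.n x - t.nA x
  o x := τ.o x + ((fun k => (t.nA x k : ℤ)) + τ.F.push t.shift x, 0)
  e a := (if a ∈ t.A.E then 0 else τ.e a) + t.ε a
  o_supp x hx := by
    by_cases hA : x ∈ t.A.N
    · simp [Colouring.cup, hA]
    · have h1 : t.nA x = 0 := by
        by_contra h
        exact hA (t.nA_supp x h)
      have h2 := t.push_shift_eq_zero hA
      have h3 : τ.o x ≠ 0 := by
        intro h
        apply hx
        rw [h, h1, h2]
        ext <;> simp
      simpa [Colouring.cup, hA] using τ.o_supp x h3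
  e_supp a ha := by
    by_cases hA : a ∈ t.A.E
    · exfalso
      apply ha
      have : t.ε a = 0 := by
        by_contra h
        exact (t.ε_supp a h).1 hA
      simp [hA, this]
    · simp only [Colouring.cup, hA, if_false] at ha ⊢
      by_contra hc
      have h1 : τ.e a = 0 := by
        by_contra h
        exact hc (τ.e_supp a h)
      have h2 : t.ε a ≠ 0 := fun h => ha (by rw [h1, h, add_zero])
      exact hA ((𝔄.admits t.mem).mem_edge hc (.inl (t.ε_supp a h2).2))

/-- The term `left ⊗ right` of the sum. -/
noncomputable def term (t : CoprodIndex 𝔄 τ) : Decorated L d × Decorated L d :=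
  (Decorated.mk t.left, Decorated.mk t.right)

theorem bideg_term (t : CoprodIndex 𝔄 τ) :
    bideg t.term = t.left.bidegree + t.right.bidegree := rfl

theorem deg_fst (t : CoprodIndex 𝔄 τ) :
    (bideg t.term).1 = τ.bidegree.1 + ∑ a, ∑ k, t.ε a k := by
  classical
  rw [bideg_term]
  change (∑ a : t.A.toForest.E, ∑ k, τ.e a.1 k) +
    (∑ a, ∑ k, ((if a ∈ t.A.E then 0 else τ.e a) + t.ε a) k) = (∑ a, ∑ k, τ.e a k) + _
  have h1 : (∑ a : t.A.toForest.E, ∑ k, τ.e a.1 k) =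
      ∑ a, if a ∈ t.A.E then ∑ k, τ.e a k else 0 := by
    rw [← Finset.sum_filter]
    exact (Finset.sum_subtype (Finset.univ.filter (· ∈ t.A.E)) (by simp)
      fun a => ∑ k, τ.e a k).symm
  rw [h1, ← Finset.sum_add_distrib, ← Finset.sum_add_distrib]
  refine Finset.sum_congr rfl fun a _ => ?_
  by_cases h : a ∈ t.A.E
  · simp [h]
  · simp [h, Finset.sum_add_distrib]

theorem card_add_le {α : Type} [Finite α] {S : Set α} (p : S → Prop) (q r : α → Prop)
    (h1 : ∀ x, p x → r x.1) (h2 : ∀ x, q x → r x ∧ x ∉ S) :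
    Nat.card {x // p x} + Nat.card {x // q x} ≤ Nat.card {x // r x} := by
  rw [← Nat.card_sum]
  refine Nat.card_le_card_of_injective
    (Sum.elim (fun x => ⟨x.1.1, h1 _ x.2⟩) fun x => ⟨x.1, (h2 _ x.2).1⟩) ?_
  rintro (x | x) (y | y) h
  · have h' : x.1.1 = y.1.1 := by simpa using h
    exact congrArg Sum.inl (Subtype.ext (Subtype.ext h'))
  · have h' : x.1.1 = y.1 := congrArg Subtype.val h
    exact absurd (h' ▸ x.1.2) (h2 _ y.2).2
  · have h' : x.1 = y.1.1 := congrArg Subtype.val h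
    exact absurd (h' ▸ y.1.2) (h2 _ x.2).2
  · have h' : x.1 = y.1 := by simpa [Subtype.ext_iff] using h
    exact congrArg Sum.inr (Subtype.ext h')

theorem deg_snd (t : CoprodIndex 𝔄 τ) : (bideg t.term).2 ≤ τ.bidegree.2 := by
  rw [bideg_term]
  change (Nat.card {x // t.left.c.node x = 0 ∧ ¬ t.left.F.IsRoot x} +
      Nat.card {a // t.left.c.edge a = 0}) +
    (Nat.card {x // t.right.c.node x = 0 ∧ ¬ t.right.F.IsRoot x} +
      Nat.card {a // t.right.c.edge a = 0}) ≤
    Nat.card {x // τ.c.node x = 0 ∧ ¬ τ.F.IsRoot x} + Nat.card {a // τ.c.edge a = 0}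
  rw [add_add_add_comm]
  refine add_le_add (card_add_le (S := t.A.N) _ _ _ ?_ ?_)
    (card_add_le (S := t.A.E) _ _ _ ?_ ?_)
  · rintro x ⟨h1, h2⟩
    exact ⟨h1, fun h => h2 fun e he => h e.1 (Subtype.ext_iff.1 he)⟩
  · rintro x ⟨h1, h2⟩
    by_cases hx : x ∈ t.A.N
    · simp [right, Colouring.cup, hx] at h1
    · exact ⟨⟨by simpa [right, Colouring.cup, hx] using h1, h2⟩, hx⟩
  · exact fun x h => h
  · intro x h1
    by_cases hx : x ∈ t.A.E
    · simp [right, Colouring.cup, hx] at h1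
    · exact ⟨by simpa [right, Colouring.cup, hx] using h1, hx⟩

theorem finite_deg (m : ℕ × ℕ) :
    {t : CoprodIndex 𝔄 τ | bideg t.term = m ∧ t.coef ≠ 0}.Finite := by
  classical
  refine Set.Finite.of_finite_image (f := fun t => (t.A, t.ε, t.nA)) ?_ ?_
  · refine (Set.finite_univ.prod ((Set.finite_Icc (0 : τ.F.E → Fin d → ℕ) fun _ _ => m.1).prod
      (Set.finite_Icc (0 : τ.F.N → Fin d → ℕ) τ.n))).subset ?_
    rintro _ ⟨t, ⟨h1, h2⟩, rfl⟩
    refine ⟨trivial, ⟨fun _ _ => Nat.zero_le _, fun a k => ?_⟩,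
      fun _ _ => Nat.zero_le _, fun x k => ?_⟩
    · have h := t.deg_fst
      rw [h1] at h
      have h3 := Finset.single_le_sum (f := fun k => t.ε a k) (fun _ _ => Nat.zero_le _)
        (Finset.mem_univ k)
      have h4 := Finset.single_le_sum (f := fun a => ∑ k, t.ε a k) (fun _ _ => Nat.zero_le _)
        (Finset.mem_univ a)
      dsimp only at h3 h4 ⊢
      omega
    · by_contra hc
      refine h2 ?_
      unfold coef
      rw [Finset.prod_eq_zero (Finset.mem_univ x), mul_zero]
      refine Finset.prod_eq_zero (Finset.mem_univ k) ?_
      rw [Nat.choose_eq_zero_of_lt (not_le.1 hc), Nat.cast_zero]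
  · intro t _ s _ h
    simp only [Prod.mk.injEq] at h
    exact CoprodIndex.ext h.1 h.2.1 h.2.2

/-- Transport of indices along an isomorphism. -/
def map {φ : τ.F.Iso σ.F} (h : τ.IsIso σ φ) (t : CoprodIndex 𝔄 τ) : CoprodIndex 𝔄 σ where
  A := t.A.map φ
  mem := 𝔄.map_mem φ h.c t.mem
  ε a := t.ε (φ.edge.symm a)
  ε_supp a ha := by
    obtain ⟨b, rfl⟩ := φ.edge.surjective a
    simp only [Equiv.symm_apply_apply] at ha
    have := t.ε_supp b ha
    exact ⟨by simpa using this.1, by simpa [φ.src_eq] using this.2⟩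
  nA x := t.nA (φ.node.symm x)
  nA_supp x hx := by
    obtain ⟨y, rfl⟩ := φ.node.surjective x
    simp only [Equiv.symm_apply_apply] at hx
    simpa using t.nA_supp y hx

theorem map_map_symm {φ : τ.F.Iso σ.F} (h : τ.IsIso σ φ) (t : CoprodIndex 𝔄 τ) :
    (t.map h).map h.symm = t := by
  apply CoprodIndex.ext
  · exact Subforest.map_symm_map φ t.A
  · funext a
    simp [map, RForest.Iso.symm]
  · funext a
    simp [map, RForest.Iso.symm]

theorem coef_map {φ : τ.F.Iso σ.F} (h : τ.IsIso σ φ) (t : CoprodIndex 𝔄 τ) :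
    (t.map h).coef = t.coef := by
  unfold coef
  rw [← Equiv.prod_comp φ.edge, ← Equiv.prod_comp φ.node]
  simp [map, h.n]

theorem term_map {φ : τ.F.Iso σ.F} (h : τ.IsIso σ φ) (t : CoprodIndex 𝔄 τ) :
    (t.map h).term = t.term := by
  classical
  refine Prod.ext (Eq.symm (Quotient.sound ?_)) (Eq.symm (Quotient.sound ?_))
  · refine ⟨Subforest.mapIso φ t.A, ⟨fun x => h.c.1 x.1, fun a => h.c.2 a.1⟩, fun x => ?_,
      fun x => h.o x.1, fun a => h.e a.1⟩
    change t.nA (φ.node.symm (φ.node x.1)) + σ.F.push (t.map h).ε (φ.node x.1) =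
      t.nA x.1 + τ.F.push t.ε x.1
    rw [Equiv.symm_apply_apply, φ.push_eq t.ε]
    intro e
    simp [map]
  · have hs : ∀ a, (t.map h).shift (φ.edge a) = t.shift a := by
      intro a
      funext k
      unfold shift
      simp [map, h.e]
    refine ⟨φ, ⟨fun (x : τ.F.N) => ?_, fun (a : τ.F.E) => ?_⟩, fun (x : τ.F.N) => ?_,
      fun (x : τ.F.N) => ?_, fun (a : τ.F.E) => ?_⟩
    · simp [map, Colouring.cup, h.c.1]
    · simp [map, Colouring.cup, h.c.2]
    · simp [map, h.n]
    · change σ.o (φ.node x) + ((fun k => ((t.map h).nA (φ.node x) k : ℤ)) +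
        σ.F.push (t.map h).shift (φ.node x), 0) = _
      rw [φ.push_eq t.shift _ hs, h.o]
      simp [map]
    · simp [map, h.e]

end CoprodIndex

open Classical in
/-- The coefficient of `y` in
`∑_{A, ε, 𝔫_A} (1 / ε!) * binom(𝔫, 𝔫_A) * (left ⊗ right)`. -/
noncomputable def PreDecorated.coprodCoeff (𝔄 : AdmissibleFamily L i) (τ : PreDecorated L d)
    (y : Decorated L d × Decorated L d) : ℝ :=
  ∑ᶠ t : CoprodIndex 𝔄 τ, if t.term = y then t.coef else 0

theorem PreDecorated.coprodCoeff_eq (𝔄 : AdmissibleFamily L i) {τ σ : PreDecorated L d}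
    (h : τ ≈ σ) : τ.coprodCoeff 𝔄 = σ.coprodCoeff 𝔄 := by
  classical
  obtain ⟨φ, h⟩ := h
  funext y
  refine finsum_eq_of_bijective (CoprodIndex.map h)
    ⟨Function.LeftInverse.injective (g := CoprodIndex.map h.symm)
      (CoprodIndex.map_map_symm h), fun t => ⟨t.map h.symm, CoprodIndex.map_map_symm h.symm t⟩⟩
    fun t => ?_
  rw [CoprodIndex.term_map, CoprodIndex.coef_map]

theorem PreDecorated.exists_of_coprodCoeff (𝔄 : AdmissibleFamily L i) {τ : PreDecorated L d}
    {y : Decorated L d × Decorated L d} (h : τ.coprodCoeff 𝔄 y ≠ 0) :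
    ∃ t : CoprodIndex 𝔄 τ, t.term = y ∧ t.coef ≠ 0 := by
  classical
  by_contra! hc
  refine h ?_
  refine finsum_eq_zero_of_forall_eq_zero fun t => ?_
  split_ifs with ht
  · exact hc t ht
  · rfl

/-- The coproduct `Δᵢ : ⟨𝔉⟩ → ⟨𝔉⟩ ⊗̂ ⟨𝔉⟩`. -/
noncomputable def coprod (d : ℕ) (𝔄 : AdmissibleFamily L i) :
    Tri (Decorated L d) (Decorated L d × Decorated L d) where
  coeff := Quotient.lift (PreDecorated.coprodCoeff 𝔄) fun _ _ h => PreDecorated.coprodCoeff_eq 𝔄 h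
  finite x m := by
    induction x using Quotient.inductionOn with
    | h τ =>
      refine ((CoprodIndex.finite_deg (𝔄 := 𝔄) (τ := τ) m).image CoprodIndex.term).subset ?_
      rintro y ⟨rfl, hy⟩
      obtain ⟨t, rfl, ht⟩ := PreDecorated.exists_of_coprodCoeff 𝔄 hy
      exact ⟨t, ⟨rfl, ht⟩, rfl⟩
  tri x y h := by
    induction x using Quotient.inductionOn with
    | h τ =>
      obtain ⟨t, rfl, ht⟩ := PreDecorated.exists_of_coprodCoeff 𝔄 h
      exact ⟨by rw [t.deg_fst]; exact Nat.le_add_right _ _, t.deg_snd⟩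

end Coproduct

/-- The map `τ₁ ⊗ τ₂ ⊗ τ₃ ⊗ τ₄ ↦ (τ₁ · τ₃) ⊗ τ₂ ⊗ τ₄`. -/
noncomputable def mul1324 (L : Type*) (d : ℕ) :
    Tri ((Decorated L d × Decorated L d) × (Decorated L d × Decorated L d))
      (Decorated L d × (Decorated L d × Decorated L d)) :=
  Tri.ofMap (fun p => (p.1.1.mul p.2.1, p.1.2, p.2.2)) fun p => by
    change bideg (p.1.1.mul p.2.1) + (bideg p.1.2 + bideg p.2.2) =
      (bideg p.1.1 + bideg p.1.2) + (bideg p.2.1 + bideg p.2.2)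
    rw [Decorated.bideg_mul, add_add_add_comm]

/-! ### Composition of triangular maps -/

/-! Both sides, evaluated on a representative `τ`, are sums over nested choices of subforests and
labels, and they are matched in two stages.

Subforests. The left side runs over `B`, `A₁` inside `B`, and `A₂` in the forest where `B` has
received colour `j`; the right side runs over `A` and `B`. The compatibility hypothesis says that
`(B, A₁, A₂) ↦ (A₂ ⊔ A₁, B)` is well defined and onto. It is injective because `B` has colour `j >
i` when `A₂` is chosen, so `A₂` avoids `B`, and `A` then determines `A₁` and `A₂` as its parts
inside and outside `B` (`AdmissibleFamily.Cointeract.equiv`).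

Labels. For fixed subforests, labels `(q, q')` of the right side determine labels `(p, p₁, p₂)` of
the left side with the same tensor term (`left_mul_left`, `right_left`, `right_right`), but this is
not one-to-one. On an edge leaving `B` the label of `p` is the sum of those of `q'` and `q`, and the
summand from `q`, the crossing label `g`, is lost. The left side compensates: its factor `binom(𝔫_B
+ πε_B, 𝔫_{A₁})` expands by Vandermonde into a sum over `g` of `binom(ε_B, g) * binom(𝔫_B, 𝔫_{A₁} -
πg)`. Once `g` is adjoined, `Labels.split` is injective and its range contains every nonzero
summand. The coefficients then agree by `1/(a! b!) = binom(a+b, a)/(a+b)!` and `binom(n, a) *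
binom(n-a, b) = binom(n, a+b) * binom(a+b, a)`; this is `tsum_labels_eq`.

Convergence. All coefficients are nonnegative, so these rearrangements take place in `ENNReal`,
where sums can be exchanged freely. Triangularity makes the sums behind each coefficient of a
composite finite, which lets the identity pass back to real coefficients. -/

/-- Both iterated sums equal the sum over the product. Joint finiteness is needed, since `finsum`
takes the value `0` on an infinite support. -/
theorem finsum_comm_of_finite {α β M : Type*} [AddCommMonoid M] (f : α → β → M)
    (h : (Function.support fun p : α × β => f p.1 p.2).Finite) :
    ∑ᶠ a, ∑ᶠ b, f a b = ∑ᶠ b, ∑ᶠ a, f a b := by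
  have h' : (Function.support fun p : β × α => f p.2 p.1).Finite :=
    (h.image Prod.swap).subset fun p hp => ⟨p.swap, hp, Prod.swap_swap p⟩
  rw [← finsum_curry (fun p : α × β => f p.1 p.2) h,
    ← finsum_curry (fun p : β × α => f p.2 p.1) h']
  exact finsum_eq_of_bijective _ (Equiv.prodComm α β).bijective fun _ => rfl

/-- The passage from the finite real sums defining coefficients to unconditional sums in `ENNReal`.
-/
theorem ENNReal.ofReal_finsum {α : Type*} (f : α → ℝ) (h0 : ∀ a, 0 ≤ f a)
    (hf : (Function.support f).Finite) :
    ENNReal.ofReal (∑ᶠ a, f a) = ∑' a, ENNReal.ofReal (f a) := by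
  rw [finsum_eq_sum f hf, ENNReal.ofReal_sum_of_nonneg fun a _ => h0 a]
  refine (tsum_eq_sum fun a ha => ?_).symm
  have : f a = 0 := by simpa using ha
  simp [this]

namespace Tri

variable {X Y Z : Type*} [Bigraded X] [Bigraded Y] [Bigraded Z]

/-- The image of a basis element, as a formal series. -/
def row (T : Tri X Y) (x : X) : Ser Y :=
  ⟨T.coeff x, T.finite x, (bideg x).2, fun y h => (T.tri x y h).2⟩

/-- The composition of triangular families. -/
noncomputable def comp (S : Tri Y Z) (T : Tri X Y) : Tri X Z where
  coeff x := (S.lin (T.row x)).1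
  finite x := (S.lin (T.row x)).2.1
  tri x z h := by
    obtain ⟨y, h1, h2⟩ := exists_of_sum_ne S (T.row x) z h
    have h1 := T.tri x y h1
    have h2 := S.tri y z h2
    exact ⟨h1.1.trans h2.1, h2.2.trans h1.2⟩

theorem comp_coeff (S : Tri Y Z) (T : Tri X Y) (x : X) (z : Z) :
    (S.comp T).coeff x z = ∑ᶠ y, T.coeff x y * S.coeff y z := rfl

theorem lin_comp (S : Tri Y Z) (T : Tri X Y) : (S.comp T).lin = S.lin ∘ₗ T.lin := by
  refine LinearMap.ext fun f => Subtype.ext (funext fun z => ?_)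
  change ∑ᶠ x, f.1 x * ∑ᶠ y, T.coeff x y * S.coeff y z =
    ∑ᶠ y, (∑ᶠ x, f.1 x * T.coeff x y) * S.coeff y z
  simp only [mul_finsum, finsum_mul, mul_assoc]
  refine finsum_comm_of_finite (fun x y => f.1 x * (T.coeff x y * S.coeff y z)) ?_
  -- Triangularity bounds the first degree of `x` by that of `z`, which leaves finitely many `x`,
  -- and each of them reaches `z` through finitely many `y`.
  refine ((finite_low f (bideg z).1).biUnion fun x _ =>
    (finite_sum S (T.row x) z).image (Prod.mk x)).subset ?_
  rintro ⟨x, y⟩ h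
  have h1 := mul_ne_zero_iff.1 h
  have h2 := mul_ne_zero_iff.1 h1.2
  simp only [Set.mem_iUnion]
  exact ⟨x, ⟨(T.tri x y h2.1).1.trans (S.tri y z h2.2).1, h1.1⟩, y, h1.2, rfl⟩

/-! ### Nonnegative families and their coefficients in `ENNReal` -/

/-- All coefficients of the family are nonnegative. -/
def Nonneg (T : Tri X Y) : Prop := ∀ x y, 0 ≤ T.coeff x y

/-- The coefficients of a nonnegative family, as extended nonnegative reals. -/
noncomputable def ecoeff (T : Tri X Y) (x : X) (y : Y) : ENNReal := ENNReal.ofReal (T.coeff x y)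

theorem Nonneg.comp {S : Tri Y Z} {T : Tri X Y} (hS : S.Nonneg) (hT : T.Nonneg) :
    (S.comp T).Nonneg := fun x _ =>
  finsum_nonneg fun y => mul_nonneg (hT x y) (hS y _)

theorem ecoeff_comp {S : Tri Y Z} {T : Tri X Y} (hS : S.Nonneg) (hT : T.Nonneg) (x : X) (z : Z) :
    (S.comp T).ecoeff x z = ∑' y, T.ecoeff x y * S.ecoeff y z := by
  unfold ecoeff
  rw [comp_coeff, ENNReal.ofReal_finsum _ (fun y => mul_nonneg (hT x y) (hS y z))
    (finite_sum S (T.row x) z)]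
  exact tsum_congr fun y => ENNReal.ofReal_mul (hT x y)

theorem Nonneg.tensor {X' Y' : Type*} [Bigraded X'] [Bigraded Y'] {T : Tri X Y} {S : Tri X' Y'}
    (hT : T.Nonneg) (hS : S.Nonneg) : (T.tensor S).Nonneg :=
  fun _ _ => mul_nonneg (hT _ _) (hS _ _)

theorem ecoeff_tensor {X' Y' : Type*} [Bigraded X'] [Bigraded Y'] {T : Tri X Y} (hT : T.Nonneg)
    (S : Tri X' Y') (p : X × X') (q : Y × Y') :
    (T.tensor S).ecoeff p q = T.ecoeff p.1 q.1 * S.ecoeff p.2 q.2 :=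
  ENNReal.ofReal_mul (hT _ _)

theorem nonneg_ofMap (φ : X → Y) (hφ : ∀ x, bideg (φ x) = bideg x) : (ofMap φ hφ).Nonneg := by
  classical
  intro x y
  change 0 ≤ if φ x = y then (1 : ℝ) else 0
  positivity

open Classical in
theorem ecoeff_ofMap (φ : X → Y) (hφ : ∀ x, bideg (φ x) = bideg x) (x : X) (y : Y) :
    (ofMap φ hφ).ecoeff x y = if φ x = y then 1 else 0 := by
  change ENNReal.ofReal (if φ x = y then (1 : ℝ) else 0) = _
  split_ifs <;> simp

theorem ecoeff_ofMap_congr {X' : Type*} [Bigraded X'] {φ : X → Y} {ψ : X' → Y}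
    (hφ : ∀ x, bideg (φ x) = bideg x) (hψ : ∀ x, bideg (ψ x) = bideg x) {x : X} {x' : X'}
    (h : φ x = ψ x') (y : Y) : (ofMap φ hφ).ecoeff x y = (ofMap ψ hψ).ecoeff x' y := by
  rw [ecoeff_ofMap, ecoeff_ofMap, h]

/-- `ENNReal.ofReal` is injective on nonnegative reals, so nothing is lost by computing in
`ENNReal`. -/
theorem ext_ecoeff {S T : Tri X Y} (hS : S.Nonneg) (hT : T.Nonneg)
    (h : ∀ x y, S.ecoeff x y = T.ecoeff x y) : S = T :=
  Tri.ext (funext fun x => funext fun y =>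
    (ENNReal.ofReal_eq_ofReal_iff (hS x y) (hT x y)).1 (h x y))

end Tri

/-- Summing against a pushed-forward weight. -/
theorem ENNReal.tsum_ite_mul {α β : Type*} [DecidableEq β] (φ : α → β) (a : α → ENNReal) (g : β → ENNReal) :
    ∑' y, (∑' t, if φ t = y then a t else 0) * g y = ∑' t, a t * g (φ t) := by
  simp_rw [← ENNReal.tsum_mul_right]
  rw [ENNReal.tsum_comm]
  refine tsum_congr fun t => ?_
  rw [tsum_eq_single (φ t)]
  · simp
  · intro y hy
    simp [hy.symm]

/-! ### Iterated coproducts as sums over indices -/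

section

variable {L : Type*} {d : ℕ} {i : ℕ+}

theorem CoprodIndex.coef_nonneg {𝔄 : AdmissibleFamily L i} {τ : PreDecorated L d}
    (t : CoprodIndex 𝔄 τ) : 0 ≤ t.coef := by
  unfold coef
  positivity

theorem coprod_nonneg (d : ℕ) (𝔄 : AdmissibleFamily L i) : (coprod d 𝔄).Nonneg := by
  classical
  intro x y
  induction x using Quotient.inductionOn with
  | h τ =>
    refine finsum_nonneg fun t => ?_
    split_ifs
    exacts [t.coef_nonneg, le_rfl]

open Classical in
theorem ecoeff_coprod (𝔄 : AdmissibleFamily L i) (τ : PreDecorated L d)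
    (y : Decorated L d × Decorated L d) :
    (coprod d 𝔄).ecoeff (Decorated.mk τ) y =
      ∑' t : CoprodIndex 𝔄 τ, if t.term = y then ENNReal.ofReal t.coef else 0 := by
  change ENNReal.ofReal (∑ᶠ t : CoprodIndex 𝔄 τ, if t.term = y then t.coef else 0) = _
  rw [ENNReal.ofReal_finsum]
  · refine tsum_congr fun t => ?_
    split_ifs <;> simp
  · intro t
    split_ifs
    exacts [t.coef_nonneg, le_rfl]
  -- All indices with term `y` share the bidegree of `y`, and only finitely many of those have
  -- nonzero coefficient.
  · refine (CoprodIndex.finite_deg (𝔄 := 𝔄) (τ := τ) (bideg y)).subset fun t ht => ?_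
    simp only [Function.mem_support, ne_eq, ite_eq_right_iff, Classical.not_imp] at ht
    exact ⟨congrArg bideg ht.1, ht.2⟩

/-- Replaces a sum over isomorphism classes by one over indices. Each index supplies concrete
representatives of both factors, on which the next coproduct can be expanded in turn. -/
theorem tsum_ecoeff_coprod (𝔄 : AdmissibleFamily L i) (τ : PreDecorated L d)
    (g : Decorated L d × Decorated L d → ENNReal) :
    ∑' y, (coprod d 𝔄).ecoeff (Decorated.mk τ) y * g y =
      ∑' t : CoprodIndex 𝔄 τ, ENNReal.ofReal t.coef * g t.term := by
  classical
  simp_rw [ecoeff_coprod]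
  exact ENNReal.tsum_ite_mul _ _ _

theorem ecoeff_mul_tensor_coprod {j : ℕ+} (𝔄 : AdmissibleFamily L i) (𝔅 : AdmissibleFamily L j)
    (τ : PreDecorated L d) (w : Decorated L d × (Decorated L d × Decorated L d)) :
    ((mul1324 L d).comp (((coprod d 𝔄).tensor (coprod d 𝔄)).comp (coprod d 𝔅))).ecoeff
      (Decorated.mk τ) w = ∑' t : CoprodIndex 𝔅 τ, ENNReal.ofReal t.coef *
        ∑' t₁ : CoprodIndex 𝔄 t.left, ENNReal.ofReal t₁.coef *
        ∑' t₂ : CoprodIndex 𝔄 t.right, ENNReal.ofReal t₂.coef *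
          (mul1324 L d).ecoeff (t₁.term, t₂.term) w := by
  have h := coprod_nonneg d 𝔄
  have h' := coprod_nonneg d 𝔅
  have hM : (mul1324 L d).Nonneg := Tri.nonneg_ofMap _ _
  rw [Tri.ecoeff_comp hM ((h.tensor h).comp h')]
  simp_rw [Tri.ecoeff_comp (h.tensor h) h', tsum_ecoeff_coprod, ← ENNReal.tsum_mul_right]
  rw [ENNReal.tsum_comm]
  refine tsum_congr fun t => ?_
  simp_rw [mul_assoc, ENNReal.tsum_mul_left]
  congr 1
  rw [ENNReal.tsum_prod']
  simp_rw [Tri.ecoeff_tensor h, mul_assoc, ENNReal.tsum_mul_left]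
  refine (tsum_ecoeff_coprod 𝔄 t.left _).trans (tsum_congr fun t₁ => ?_)
  congr 1
  exact tsum_ecoeff_coprod 𝔄 t.right _

theorem ecoeff_one_tensor_coprod {j : ℕ+} (𝔄 : AdmissibleFamily L i) (𝔅 : AdmissibleFamily L j)
    (τ : PreDecorated L d) (w : Decorated L d × (Decorated L d × Decorated L d)) :
    (((Tri.one.tensor (coprod d 𝔅))).comp (coprod d 𝔄)).ecoeff
      (Decorated.mk τ) w = ∑' s : CoprodIndex 𝔄 τ, ENNReal.ofReal s.coef *
        ∑' s' : CoprodIndex 𝔅 s.right, ENNReal.ofReal s'.coef *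
          (Tri.one (X := Decorated L d × (Decorated L d × Decorated L d))).ecoeff
            (Decorated.mk s.left, s'.term) w := by
  classical
  have h := coprod_nonneg d 𝔄
  have h' := coprod_nonneg d 𝔅
  have h1 : (Tri.one (X := Decorated L d)).Nonneg := Tri.nonneg_ofMap _ _
  rw [Tri.ecoeff_comp (h1.tensor h') h, tsum_ecoeff_coprod]
  refine tsum_congr fun s => ?_
  congr 1
  rw [Tri.ecoeff_tensor h1]
  refine ((congrArg _ (ecoeff_coprod 𝔅 s.right w.2)).trans ?_)
  rw [← ENNReal.tsum_mul_left]
  refine tsum_congr fun s' => ?_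
  unfold Tri.one
  -- The indicator for the first factor times the indicator for the other two is the indicator for
  -- the triple.
  simp only [Tri.ecoeff_ofMap, CoprodIndex.term, Prod.ext_iff]
  split_ifs <;> simp_all

end

/-! ### Vandermonde identity along a map -/

/-- `binom(n, m - k)`, with the value `0` for `k > m`. -/
def chooseSub (n m k : ℕ) : ℕ := if k ≤ m then n.choose (m - k) else 0

/-- Vandermonde's identity for `binom(n + r, m - k)`. The zero convention for `k > m` matters:
truncated subtraction would turn those binomials into `1`. -/
theorem chooseSub_add (n r m k : ℕ) :
    chooseSub (n + r) m k = ∑ l ∈ Finset.range (r + 1), r.choose l * chooseSub n m (k + l) := by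
  unfold chooseSub
  split_ifs with h
  · rw [add_comm n r, Nat.add_choose_eq, Finset.Nat.sum_antidiagonal_eq_sum_range_succ_mk]
    have h1 : ∀ l, l ∉ Finset.range (r + 1) →
        (r.choose l * if k + l ≤ m then n.choose (m - (k + l)) else 0) = 0 := by
      intro l hl
      rw [Nat.choose_eq_zero_of_lt (by simpa using hl), zero_mul]
    have h2 : ∀ l, l ∉ Finset.range (m - k + 1) →
        (r.choose l * if k + l ≤ m then n.choose (m - (k + l)) else 0) = 0 := by
      intro l hl
      rw [if_neg (by simp at hl; omega), mul_zero]
    -- Vandermonde gives the range `l ≤ m - k`, the statement has `l ≤ r`; the nonzero terms lie in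
    -- both.
    have h3 : (∑ l ∈ Finset.range (r + 1),
        r.choose l * if k + l ≤ m then n.choose (m - (k + l)) else 0) =
        ∑ l ∈ Finset.range (m - k + 1),
          r.choose l * if k + l ≤ m then n.choose (m - (k + l)) else 0 := by
      rw [← finsum_eq_sum_of_support_subset (s := Finset.range (r + 1)),
        ← finsum_eq_sum_of_support_subset (s := Finset.range (m - k + 1))]
      · intro l hl
        by_contra h
        exact hl (h2 l h)
      · intro l hl
        by_contra h
        exact hl (h1 l h)
    rw [h3]
    refine Finset.sum_congr rfl fun l hl => ?_
    rw [if_pos (by simp at hl; omega), Nat.sub_sub]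
  · rw [Finset.sum_eq_zero]
    intro l _
    rw [if_neg (by omega), mul_zero]

open Classical in
-- Induction on `ι`, splitting off one summand `r a` at a time by the one-variable identity. No
-- bound on `g` is imposed, because `binom(r a, g a)` vanishes for `g a > r a`.
theorem tsum_vandermonde {κ : Type} [Fintype κ] (m : κ → ℕ) (ι : Type) [Fintype ι] :
    ∀ (p : ι → κ) (r : ι → ℕ) (n : κ → ℕ),
    ((∏ x, (n x + ∑ a, if p a = x then r a else 0).choose (m x) : ℕ) : ENNReal) =
      ∑' g : ι → ℕ, (((∏ a, (r a).choose (g a)) *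
        ∏ x, chooseSub (n x) (m x) (∑ a, if p a = x then g a else 0) : ℕ) : ENNReal) := by
  refine Fintype.induction_empty_option (P := fun ι _ => ∀ (p : ι → κ) (r : ι → ℕ) (n : κ → ℕ),
    ((∏ x, (n x + ∑ a, if p a = x then r a else 0).choose (m x) : ℕ) : ENNReal) =
      ∑' g : ι → ℕ, (((∏ a, (r a).choose (g a)) *
        ∏ x, chooseSub (n x) (m x) (∑ a, if p a = x then g a else 0) : ℕ) : ENNReal)) ?_ ?_ ?_ ι
  · intro α β _ e ih p r n
    let := Fintype.ofEquiv β e.symm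
    have := ih (p ∘ e) (r ∘ e) n
    rw [← (Equiv.arrowCongr e (Equiv.refl ℕ)).tsum_eq]
    simp only [Function.comp_apply] at this
    simp_rw [← e.sum_comp, ← e.prod_comp]
    simpa using this
  · intro p r n
    rw [tsum_eq_single (fun a => a.elim) (fun g hg => absurd (Subsingleton.elim _ _) hg)]
    simp [chooseSub]
  · intro α _ ih p r n
    -- The new summand `r none` is first absorbed into the base value at `p none`. Only the factor
    -- at that point depends on it, and `chooseSub_add` splits it off again.
    have h := ih (fun a => p (some a)) (fun a => r (some a))
      (fun x => n x + if p none = x then r none else 0)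
    simp only [Fintype.sum_option, Fintype.prod_option, ← add_assoc]
    rw [h, ← (Equiv.piOptionEquivProd (β := fun _ => ℕ)).symm.tsum_eq, ENNReal.tsum_prod',
      ENNReal.tsum_comm]
    refine tsum_congr fun g => ?_
    rw [tsum_eq_sum (s := Finset.range (r none + 1)), ← Nat.cast_sum]
    · congr 1
      simp only [Equiv.piOptionEquivProd_symm_apply]
      rw [← Finset.mul_prod_erase Finset.univ _ (Finset.mem_univ (p none))]
      simp only [if_true]
      rw [chooseSub_add, Finset.sum_mul, Finset.mul_sum]
      refine Finset.sum_congr rfl fun l _ => ?_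
      rw [← Finset.mul_prod_erase Finset.univ (fun x => chooseSub (n x) (m x) _)
        (Finset.mem_univ (p none))]
      have : ∀ k, (∏ x ∈ Finset.univ.erase (p none), chooseSub (n x + if p none = x then k else 0)
          (m x) (∑ a, if p (some a) = x then g a else 0)) =
          ∏ x ∈ Finset.univ.erase (p none), chooseSub (n x) (m x)
            ((if p none = x then l else 0) + ∑ a, if p (some a) = x then g a else 0) := by
        intro k
        refine Finset.prod_congr rfl fun x hx => ?_
        have hx := (Finset.mem_erase.1 hx).1.symm
        simp [hx]
      rw [this]
      simp [add_comm l]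
      ring
    · intro l hl
      simp [Nat.choose_eq_zero_of_lt (show r none < l by simpa using hl)]

namespace RForest

variable {L : Type*} {d : ℕ} (F : RForest L)

theorem push_apply {M : Type*} [AddCommMonoid M] (f : F.E → Fin d → M) (x : F.N) (k : Fin d) :
    F.push f x k = F.push (fun a => f a k) x := by
  unfold push
  rw [Finset.sum_apply]
  exact Finset.sum_congr rfl fun a _ => by split_ifs <;> rfl

variable {F} in
theorem push_congr {M : Type*} [AddCommMonoid M] {f g : F.E → M} {x : F.N}
    (h : ∀ a, F.src a = x → f a = g a) : F.push f x = F.push g x := by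
  unfold push
  refine Finset.sum_congr rfl fun a _ => ?_
  split_ifs with hx
  exacts [h a hx, rfl]

theorem push_add {M : Type*} [AddCommMonoid M] (f g : F.E → M) (x : F.N) :
    F.push (fun a => f a + g a) x = F.push f x + F.push g x := by
  unfold push
  rw [← Finset.sum_add_distrib]
  exact Finset.sum_congr rfl fun a _ => by split_ifs <;> simp

theorem push_natCast (f : F.E → Fin d → ℕ) (x : F.N) :
    F.push (fun a k => (f a k : ℤ)) x = fun k => (F.push f x k : ℤ) := by
  funext k
  simp only [push_apply]
  unfold push
  push_cast
  rfl

variable {F} in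
theorem exists_of_push_ne_zero {M : Type*} [AddCommMonoid M] {f : F.E → M} {x : F.N}
    (h : F.push f x ≠ 0) : ∃ a, F.src a = x ∧ f a ≠ 0 := by
  unfold push at h
  obtain ⟨a, -, ha⟩ := Finset.exists_ne_zero_of_sum_ne_zero h
  exact ⟨a, by simpa using ha⟩

open Classical in
theorem push_toForest {F : RForest L} (B : Subforest F) {M : Type*} [AddCommMonoid M]
    (f : F.E → M) (x : B.N) :
    B.toForest.push (fun a : B.E => f a.1) x = F.push (fun a => if a ∈ B.E then f a else 0) x.1 := by
  unfold push
  have h : ∀ a, (if F.src a = x.1 then if a ∈ B.E then f a else 0 else 0) =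
      if a ∈ B.E then (if F.src a = x.1 then f a else 0) else 0 := by
    intro a
    split_ifs <;> rfl
  simp_rw [h]
  refine Eq.trans ?_ ((Finset.sum_subtype (F := B.toForest.fE) (Finset.univ.filter (· ∈ B.E))
    (by simp) fun a => if F.src a = x.1 then f a else 0).symm.trans (Finset.sum_filter _ _))
  refine Finset.sum_congr rfl fun a _ => ?_
  exact if_congr Subtype.ext_iff rfl rfl

theorem tsum_vandermonde_push (r : F.E → Fin d → ℕ) (n m : F.N → Fin d → ℕ) :
    ((∏ x, ∏ k, (n x k + F.push r x k).choose (m x k) : ℕ) : ENNReal) =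
      ∑' g : F.E → Fin d → ℕ, (((∏ a, ∏ k, (r a k).choose (g a k)) *
        ∏ x, ∏ k, chooseSub (n x k) (m x k) (F.push g x k) : ℕ) : ENNReal) := by
  classical
  -- Edges and nodes are paired with a coordinate, and the map sends an edge to its source while
  -- keeping the coordinate; its fibre sums are the values of `push`.
  have h := tsum_vandermonde (fun y : F.N × Fin d => m y.1 y.2) (F.E × Fin d)
    (Prod.map F.src id) (fun y => r y.1 y.2) (fun y => n y.1 y.2)
  have hs : ∀ (f : F.E → Fin d → ℕ) (x : F.N) (k : Fin d),
      (∑ a : F.E × Fin d, if Prod.map F.src id a = (x, k) then f a.1 a.2 else 0) =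
        F.push f x k := by
    intro f x k
    rw [push_apply, Fintype.sum_prod_type]
    unfold push
    refine Finset.sum_congr rfl fun a _ => ?_
    by_cases hx : F.src a = x <;> simp [hx]
  rw [← (Equiv.curry F.E (Fin d) ℕ).symm.tsum_eq] at h
  simp only [Fintype.prod_prod_type, Equiv.curry_symm_apply, Function.uncurry] at h
  simp only [← hs]
  convert h

end RForest

/-- Zero labels contribute the factor `1`. Coefficients computed inside `B` thus become products
over all of `F`, comparable with the others factor by factor. -/
theorem Fintype.prod_extend {α R M : Type*} [Fintype α] [CommMonoid R] [Zero M] (S : Set α)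
    [Fintype S] (f : S → M) (φ : α → M → R) (hφ : ∀ a, φ a 0 = 1) :
    ∏ s : S, φ s (f s) = ∏ a, φ a (Function.extend Subtype.val f 0 a) := by
  classical
  refine Fintype.prod_of_injective Subtype.val Subtype.val_injective _ _ ?_ ?_
  · intro a ha
    rw [Function.extend_apply' _ _ _ (by simpa using ha)]
    exact hφ a
  · intro s
    rw [Subtype.val_injective.extend_apply]

/-! ### Edge and node labels on a subforest -/

/-- The labels `ε` on `∂(A,F)` and `𝔫` on `N_A` that occur in the coproducts. -/
@[ext]
structure Labels {L : Type*} {F : RForest L} (d : ℕ) (A : Subforest F) where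
  ε : F.E → Fin d → ℕ
  ε_supp : ∀ a, ε a ≠ 0 → a ∈ A.boundary
  n : F.N → Fin d → ℕ
  n_supp : ∀ x, n x ≠ 0 → x ∈ A.N

namespace CoprodIndex

variable {L : Type*} {d : ℕ} {i : ℕ+} {𝔄 : AdmissibleFamily L i} {τ : PreDecorated L d}

/-- The index of a coproduct given by an admissible subforest and labels on it. -/
abbrev of {A : Subforest τ.F} (h : A ∈ 𝔄.sub τ.c) (p : Labels d A) : CoprodIndex 𝔄 τ :=
  ⟨A, h, p.ε, p.ε_supp, p.n, p.n_supp⟩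

variable (𝔄 τ) in
/-- Indices of a coproduct as pairs of a subforest and labels. -/
def equivSigma : (Σ A : {A : Subforest τ.F // A ∈ 𝔄.sub τ.c}, Labels d A.1) ≃ CoprodIndex 𝔄 τ where
  toFun q := of q.1.2 q.2
  invFun t := ⟨⟨t.A, t.mem⟩, ⟨t.ε, t.ε_supp, t.nA, t.nA_supp⟩⟩
  left_inv _ := rfl
  right_inv _ := rfl

theorem tsum_eq (f : CoprodIndex 𝔄 τ → ENNReal) :
    ∑' t, f t = ∑' A : {A : Subforest τ.F // A ∈ 𝔄.sub τ.c}, ∑' p : Labels d A.1, f (of A.2 p) := by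
  rw [← (equivSigma 𝔄 τ).tsum_eq, ENNReal.tsum_sigma']
  rfl

end CoprodIndex

/-! ### Unions of a subforest outside `B` and one inside `B` -/

namespace Subforest

variable {L : Type*} {F : RForest L} {B A₂ : Subforest F} {A₁ : Subforest B.toForest}

theorem mem_union_lift_node (hd : A₂.Disj B) {x : F.N} (hx : x ∈ B.N) :
    x ∈ (A₂.union (lift A₁)).N ↔ (⟨x, hx⟩ : B.N) ∈ A₁.N :=
  ⟨fun h => h.elim (fun h => absurd hx (Set.disjoint_left.1 hd h)) fun ⟨_, h⟩ => h,
    fun h => .inr ⟨hx, h⟩⟩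

theorem mem_union_lift_node_of_notMem {x : F.N} (hx : x ∉ B.N) :
    x ∈ (A₂.union (lift A₁)).N ↔ x ∈ A₂.N :=
  ⟨fun h => h.elim id fun ⟨h, _⟩ => absurd h hx, .inl⟩

theorem notMem_edge_of_src (hd : A₂.Disj B) {a : F.E} (ha : F.src a ∈ B.N) : a ∉ A₂.E :=
  fun h => Set.disjoint_left.1 hd (A₂.src_mem a h) ha

theorem mem_union_lift_edge (hd : A₂.Disj B) {a : F.E} (ha : a ∈ B.E) :
    a ∈ (A₂.union (lift A₁)).E ↔ (⟨a, ha⟩ : B.E) ∈ A₁.E :=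
  ⟨fun h => h.elim (fun h => absurd h (notMem_edge_of_src hd (B.src_mem a ha))) fun ⟨_, h⟩ => h,
    fun h => .inr ⟨ha, h⟩⟩

theorem mem_union_lift_edge_of_notMem {a : F.E} (ha : a ∉ B.E) :
    a ∈ (A₂.union (lift A₁)).E ↔ a ∈ A₂.E :=
  ⟨fun h => h.elim id fun ⟨h, _⟩ => absurd h ha, .inl⟩

/-- The part of the union inside `B` is `A₁` and the part outside is `A₂`, as `A₂` does not meet
`B`. -/
theorem eq_of_union_lift_eq {A₂' : Subforest F} {A₁' : Subforest B.toForest} (hd : A₂.Disj B)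
    (hd' : A₂'.Disj B) (h : A₂.union (lift A₁) = A₂'.union (lift A₁')) : A₂ = A₂' ∧ A₁ = A₁' := by
  refine ⟨Subforest.ext (Set.ext fun x => ?_) (Set.ext fun a => ?_),
    Subforest.ext (Set.ext fun x => ?_) (Set.ext fun a => ?_)⟩
  · by_cases hx : x ∈ B.N
    · exact ⟨fun h => absurd hx (Set.disjoint_left.1 hd h),
        fun h => absurd hx (Set.disjoint_left.1 hd' h)⟩
    · rw [← mem_union_lift_node_of_notMem (A₁ := A₁) hx, h, mem_union_lift_node_of_notMem hx]
  · by_cases ha : a ∈ B.E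
    · exact ⟨fun h => absurd h (notMem_edge_of_src hd (B.src_mem a ha)),
        fun h => absurd h (notMem_edge_of_src hd' (B.src_mem a ha))⟩
    · rw [← mem_union_lift_edge_of_notMem (A₁ := A₁) ha, h, mem_union_lift_edge_of_notMem ha]
  · exact (mem_union_lift_node hd x.2).symm.trans
      ((Set.ext_iff.1 (congrArg Subforest.N h) x.1).trans (mem_union_lift_node hd' x.2))
  · exact (mem_union_lift_edge hd a.2).symm.trans
      ((Set.ext_iff.1 (congrArg Subforest.E h) a.1).trans (mem_union_lift_edge hd' a.2))

/-- The disjoint union of `A₁` and `A₂` as a forest and as a subforest. -/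
noncomputable def unionLiftIso (hd : A₂.Disj B) :
    (A₁.toForest.disjUnion A₂.toForest).Iso (A₂.union (lift A₁)).toForest where
  node := Equiv.ofBijective
    (Sum.elim (fun x : A₁.N => (⟨x.1.1, .inr ⟨x.1.2, x.2⟩⟩ : (A₂.union (lift A₁)).N))
      fun x : A₂.N => ⟨x.1, .inl x.2⟩) (by
    constructor
    · rintro (x | x) (y | y) h
      · have h' : x.1.1 = y.1.1 := by
          have := congrArg Subtype.val h
          exact this
        exact congrArg Sum.inl (Subtype.ext (Subtype.ext h'))
      · have h' : x.1.1 = y.1 := by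
          have := congrArg Subtype.val h
          exact this
        exact absurd (h' ▸ x.1.2) (Set.disjoint_left.1 hd y.2)
      · have h' : x.1 = y.1.1 := by
          have := congrArg Subtype.val h
          exact this
        exact absurd (h' ▸ y.1.2) (Set.disjoint_left.1 hd x.2)
      · have h' : x.1 = y.1 := by
          have := congrArg Subtype.val h
          exact this
        exact congrArg Sum.inr (Subtype.ext h')
    · rintro ⟨x, hx | ⟨hx, hx'⟩⟩
      · exact ⟨.inr ⟨x, hx⟩, rfl⟩
      · exact ⟨.inl ⟨⟨x, hx⟩, hx'⟩, rfl⟩)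
  edge := Equiv.ofBijective
    (Sum.elim (fun a : A₁.E => (⟨a.1.1, .inr ⟨a.1.2, a.2⟩⟩ : (A₂.union (lift A₁)).E))
      fun a : A₂.E => ⟨a.1, .inl a.2⟩) (by
    have hE : ∀ a ∈ A₂.E, a ∉ B.E := fun a h h' => notMem_edge_of_src hd (B.src_mem a h') h
    constructor
    · rintro (x | x) (y | y) h
      · have h' : x.1.1 = y.1.1 := by
          have := congrArg Subtype.val h
          exact this
        exact congrArg Sum.inl (Subtype.ext (Subtype.ext h'))
      · have h' : x.1.1 = y.1 := by
          have := congrArg Subtype.val h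
          exact this
        exact absurd (h' ▸ x.1.2) (hE _ y.2)
      · have h' : x.1 = y.1.1 := by
          have := congrArg Subtype.val h
          exact this
        exact absurd (h' ▸ y.1.2) (hE _ x.2)
      · have h' : x.1 = y.1 := by
          have := congrArg Subtype.val h
          exact this
        exact congrArg Sum.inr (Subtype.ext h')
    · rintro ⟨x, hx | ⟨hx, hx'⟩⟩
      · exact ⟨.inr ⟨x, hx⟩, rfl⟩
      · exact ⟨.inl ⟨⟨x, hx⟩, hx'⟩, rfl⟩)
  src_eq := by rintro (a | a) <;> rfl
  tgt_eq := by rintro (a | a) <;> rfl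
  typ_eq := by rintro (a | a) <;> rfl

end Subforest

/-! ### Change of variables between the labels of the two sides -/

namespace Labels

open Subforest

variable {L : Type*} {F : RForest L} {d : ℕ} {B A₂ : Subforest F} {A₁ : Subforest B.toForest}

theorem ε_eq_zero {A : Subforest F} (p : Labels d A) {a : F.E} (ha : a ∉ A.boundary) :
    p.ε a = 0 := by
  by_contra h
  exact ha (p.ε_supp a h)

theorem n_eq_zero {A : Subforest F} (p : Labels d A) {x : F.N} (hx : x ∉ A.N) : p.n x = 0 := by
  by_contra h
  exact hx (p.n_supp x h)

open Classical in
/-- The part of the edge labels that lives on the boundary of `B`. -/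
noncomputable def crossing (q : Labels d (A₂.union (lift A₁))) (a : F.E) : Fin d → ℕ :=
  if a ∉ B.E ∧ F.src a ∈ B.N then q.ε a else 0

open Classical in
/-- The labels on `B` in `(Δᵢ ⊗ Δᵢ) Δⱼ` that belong to labels in `(id ⊗ Δⱼ) Δᵢ`. -/
noncomputable def outer (q : Labels d (A₂.union (lift A₁))) (q' : Labels d B) : Labels d B where
  ε a := q'.ε a + q.crossing a
  ε_supp a ha := by
    by_contra h
    rw [q'.ε_eq_zero h, zero_add] at ha
    unfold crossing at ha
    split_ifs at ha with h'
    · exact h h'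
    · exact ha rfl
  n x := q'.n x + if x ∈ B.N then q.n x else 0
  n_supp x hx := by
    by_contra h
    exact hx (by simp [q'.n_eq_zero h, h])

/-- A labelled crossing edge starts in `A₂ ⊔ A₁` and in `B`, hence at a node of `A₁`. -/
theorem push_crossing_eq_zero (hd : A₂.Disj B) (q : Labels d (A₂.union (lift A₁))) {x : F.N}
    (hx : ¬ ∃ h : x ∈ B.N, (⟨x, h⟩ : B.N) ∈ A₁.N) : F.push q.crossing x = 0 := by
  by_contra h
  obtain ⟨a, rfl, ha⟩ := RForest.exists_of_push_ne_zero h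
  unfold crossing at ha
  split_ifs at ha with h'
  · exact hx ⟨h'.2, (mem_union_lift_node hd h'.2).1 (q.ε_supp a ha).2⟩
  · exact ha rfl

/-- The labels on `A₁` in `(Δᵢ ⊗ Δᵢ) Δⱼ` that belong to labels in `(id ⊗ Δⱼ) Δᵢ`. -/
noncomputable def inside (hd : A₂.Disj B) (q : Labels d (A₂.union (lift A₁))) : Labels d A₁ where
  ε a := q.ε a.1
  ε_supp a ha := ⟨fun h => (q.ε_supp a.1 ha).1 ((mem_union_lift_edge hd a.2).2 h),
    (mem_union_lift_node hd (B.src_mem a.1 a.2)).1 (q.ε_supp a.1 ha).2⟩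
  n x := q.n x.1 + F.push q.crossing x.1
  n_supp x hx := by
    by_contra h
    refine hx ?_
    rw [q.n_eq_zero fun h' => h ((mem_union_lift_node hd x.2).1 h'),
      push_crossing_eq_zero hd q fun ⟨_, h'⟩ => h h', add_zero]

open Classical in
/-- The labels on `A₂` in `(Δᵢ ⊗ Δᵢ) Δⱼ` that belong to labels in `(id ⊗ Δⱼ) Δᵢ`. -/
noncomputable def outside (q : Labels d (A₂.union (lift A₁))) : Labels d A₂ where
  ε a := if F.src a ∈ B.N then 0 else q.ε a
  ε_supp a ha := by
    split_ifs at ha with h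
    · exact absurd rfl ha
    · exact ⟨fun h' => (q.ε_supp a ha).1 (.inl h'),
        (mem_union_lift_node_of_notMem h).1 (q.ε_supp a ha).2⟩
  n x := if x ∈ B.N then 0 else q.n x
  n_supp x hx := by
    split_ifs at hx with h
    · exact absurd rfl hx
    · exact (mem_union_lift_node_of_notMem h).1 (q.n_supp x hx)

/-- The change of variables between the two iterated coproducts. -/
noncomputable def split (hd : A₂.Disj B) (q : Labels d (A₂.union (lift A₁)) × Labels d B) :
    Labels d B × Labels d A₁ × Labels d A₂ × (F.E → Fin d → ℕ) :=
  (q.1.outer q.2, q.1.inside hd, q.1.outside, q.1.crossing)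

/-- Knowing the crossing labels allows them to be subtracted: `q` is read off from the labels inside
`B`, outside `B` and on crossing edges, and then `q'` is what remains of the labels on `B`. -/
theorem split_injective (hd : A₂.Disj B) :
    Function.Injective (split (d := d) (A₁ := A₁) hd) := by
  rintro ⟨q, q'⟩ ⟨s, s'⟩ h
  simp only [split, Prod.mk.injEq] at h
  obtain ⟨h1, h2, h3, h4⟩ := h
  have hn : ∀ x, q.n x = s.n x := by
    intro x
    by_cases hx : x ∈ B.N
    · have h := congrFun (congrArg Labels.n h2) ⟨x, hx⟩
      change q.n x + F.push q.crossing x = s.n x + F.push s.crossing x at h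
      rw [h4] at h
      exact add_right_cancel h
    · have h := congrFun (congrArg Labels.n h3) x
      simpa [outside, hx] using h
  have hε : ∀ a, q.ε a = s.ε a := by
    intro a
    by_cases ha : a ∈ B.E
    · exact congrFun (congrArg Labels.ε h2) ⟨a, ha⟩
    · by_cases hx : F.src a ∈ B.N
      · have h := congrFun h4 a
        simpa [crossing, ha, hx] using h
      · have h := congrFun (congrArg Labels.ε h3) a
        simpa [outside, hx] using h
  refine Prod.ext (Labels.ext (funext hε) (funext hn)) (Labels.ext (funext fun a => ?_)
    (funext fun x => ?_))
  · have h := congrFun (congrArg Labels.ε h1) a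
    change q'.ε a + q.crossing a = s'.ε a + s.crossing a at h
    rw [h4] at h
    exact add_right_cancel h
  · have h := congrFun (congrArg Labels.n h1) x
    simp only [outer, hn] at h
    exact add_right_cancel h

open Classical in
-- The three inequalities hold whenever the Vandermonde summand of `g` is nonzero. They make the
-- truncated subtractions in the explicit preimage genuine.
theorem mem_range_split (hd : A₂.Disj B) (p : Labels d B) (p₁ : Labels d A₁) (p₂ : Labels d A₂)
    (g : F.E → Fin d → ℕ) (h1 : g ≤ p.ε) (h2 : F.push g ≤ Function.extend Subtype.val p₁.n 0)
    (h3 : Function.extend Subtype.val p₁.n 0 ≤ p.n + F.push g) :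
    (p, p₁, p₂, g) ∈ Set.range (split (d := d) (A₁ := A₁) hd) := by
  have he : ∀ x (hx : x ∈ B.N), Function.extend Subtype.val p₁.n 0 x = p₁.n ⟨x, hx⟩ :=
    fun x hx => Subtype.val_injective.extend_apply p₁.n 0 (⟨x, hx⟩ : B.N)
  -- The bound by `p.ε` places the edge on the boundary of `B`; the bound of `push g` by `p₁.n`,
  -- which vanishes off `A₁`, places its source in `A₁`.
  have hg : ∀ a, g a ≠ 0 → ∃ h : F.src a ∈ B.N, (⟨F.src a, h⟩ : B.N) ∈ A₁.N ∧ a ∉ B.E := by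
    intro a ha
    have hb : p.ε a ≠ 0 := fun h0 => ha (le_antisymm (h0 ▸ h1 a) zero_le)
    have hb := p.ε_supp a hb
    refine ⟨hb.2, ?_, hb.1⟩
    apply p₁.n_supp
    intro h0
    have h2 := h2 (F.src a)
    rw [he _ hb.2, h0] at h2
    refine ha (le_antisymm (le_trans ?_ h2) zero_le)
    unfold RForest.push
    refine le_trans ?_ (Finset.single_le_sum (f := fun b => if F.src b = F.src a then g b else 0)
      (fun _ _ => zero_le) (Finset.mem_univ a))
    simp
  have hsub : ∀ x (hx : x ∈ B.N), p₁.n ⟨x, hx⟩ - F.push g x + F.push g x = p₁.n ⟨x, hx⟩ := by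
    intro x hx
    refine tsub_add_cancel_of_le ?_
    rw [← he x hx]
    exact h2 x
  let q : Labels d (A₂.union (lift A₁)) :=
    { ε := fun a => if h : a ∈ B.E then p₁.ε ⟨a, h⟩ else if F.src a ∈ B.N then g a else p₂.ε a
      ε_supp := by
        intro a ha
        split_ifs at ha with h h'
        · have := p₁.ε_supp ⟨a, h⟩ ha
          exact ⟨fun h' => this.1 ((mem_union_lift_edge hd h).1 h'),
            (mem_union_lift_node hd (B.src_mem a h)).2 this.2⟩
        · obtain ⟨h3, h4, h5⟩ := hg a ha
          exact ⟨fun h' => notMem_edge_of_src hd h3 ((mem_union_lift_edge_of_notMem h5).1 h'),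
            (mem_union_lift_node hd h3).2 h4⟩
        · have := p₂.ε_supp a ha
          exact ⟨fun h' => this.1 ((mem_union_lift_edge_of_notMem h).1 h'), .inl this.2⟩
      n := fun x => if h : x ∈ B.N then p₁.n ⟨x, h⟩ - F.push g x else p₂.n x
      n_supp := by
        intro x hx
        split_ifs at hx with h
        · refine (mem_union_lift_node hd h).2 (p₁.n_supp _ fun h0 => hx ?_)
          rw [h0, zero_tsub]
        · exact .inl (p₂.n_supp x hx) }
  let q' : Labels d B :=
    { ε := fun a => p.ε a - g a
      ε_supp := fun a ha => p.ε_supp a fun h0 => ha (by rw [h0, zero_tsub])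
      n := fun x => p.n x - if x ∈ B.N then q.n x else 0
      n_supp := fun x hx => p.n_supp x fun h0 => hx (by rw [h0, zero_tsub]) }
  have hc : q.crossing = g := by
    funext a
    unfold crossing
    split_ifs with h
    · simp [q, h.1, h.2]
    · by_contra h0
      obtain ⟨h3, -, h5⟩ := hg a (Ne.symm h0)
      exact h ⟨h5, h3⟩
  refine ⟨(q, q'), Prod.ext (Labels.ext (funext fun a => ?_) (funext fun x => ?_))
    (Prod.ext (Labels.ext (funext fun a => ?_) (funext fun x => ?_))
      (Prod.ext (Labels.ext (funext fun a => ?_) (funext fun x => ?_)) hc))⟩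
  · change p.ε a - g a + q.crossing a = p.ε a
    rw [hc]
    exact tsub_add_cancel_of_le (h1 a)
  · change (p.n x - if x ∈ B.N then q.n x else 0) + (if x ∈ B.N then q.n x else 0) = p.n x
    refine tsub_add_cancel_of_le ?_
    split_ifs with hx
    · simp only [q, hx, dif_pos]
      have := h3 x
      rw [he x hx] at this
      exact tsub_le_iff_right.2 this
    · exact zero_le
  · change q.ε a.1 = p₁.ε a
    have ha : a.1 ∈ B.E := a.2
    simp only [q, ha, dif_pos]
    rfl
  · change q.n x.1 + F.push q.crossing x.1 = p₁.n x
    have hx : x.1 ∈ B.N := x.2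
    rw [hc]
    simp only [q, hx, dif_pos]
    exact hsub x.1 hx
  · change (if F.src a ∈ B.N then 0 else q.ε a) = p₂.ε a
    split_ifs with h
    · exact (p₂.ε_eq_zero fun h' => Set.disjoint_left.1 hd h'.2 h).symm
    · have ha : a ∉ B.E := fun h' => h (B.src_mem a h')
      simp [q, ha, h]
  · change (if x ∈ B.N then 0 else q.n x) = p₂.n x
    split_ifs with h
    · exact (p₂.n_eq_zero fun h' => Set.disjoint_left.1 hd h' h).symm
    · simp [q, h]

end Labels

/-! ### Comparison of the three tensor factors -/

/-- Here `i < j` enters: `B` now carries colour `j`, and a subforest admissible for `i` avoids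
larger colours. -/
theorem AdmissibleFamily.disj_of_mem_cup {L : Type*} {i j : ℕ+} {𝔄 : AdmissibleFamily L i}
    {F : RForest L} {c : Colouring F} {A B : Subforest F} (hij : i < j) (hB : c.Admits j B)
    (hA : A ∈ 𝔄.sub (c.cup j B hB)) : A.Disj B := by
  refine Disjoint.symm (Disjoint.mono_left (fun x hx => ?_) ((𝔄.admits hA).disj j hij))
  change (c.cup j B hB).node x = j
  simp [Colouring.cup, hx]

namespace CoprodIndex

open Subforest

variable {L : Type*} {d : ℕ} {i j : ℕ+} {𝔄 : AdmissibleFamily L i} {𝔅 : AdmissibleFamily L j}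
  {τ : PreDecorated L d} {B A₂ : Subforest τ.F} {A₁ : Subforest B.toForest}

theorem shift_eq {A : Subforest τ.F} (hA : A ∈ 𝔄.sub τ.c) (p : Labels d A) (a : τ.F.E)
    [Decidable (a ∈ A.E)] :
    (of hA p).shift a = (fun k => (p.ε a k : ℤ)) - if a ∈ A.E then fun k => (τ.e a k : ℤ) else 0 := by
  funext k
  unfold shift
  by_cases h : a ∈ A.E <;> simp [h]

/-- The first index of `(Δᵢ ⊗ Δᵢ) Δⱼ`, for the left factor. -/
noncomputable abbrev ofLeft (hB : B ∈ 𝔅.sub τ.c) (p : Labels d B) (h₁ : A₁ ∈ 𝔄.sub (τ.c.restrict B))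
    (p₁ : Labels d A₁) : CoprodIndex 𝔄 (of hB p).left := of h₁ p₁

/-- The second index of `(Δᵢ ⊗ Δᵢ) Δⱼ`, for the right factor. -/
noncomputable abbrev ofRight (hB : B ∈ 𝔅.sub τ.c) (p : Labels d B)
    (h₂ : A₂ ∈ 𝔄.sub (τ.c.cup j B (𝔅.admits hB))) (p₂ : Labels d A₂) :
    CoprodIndex 𝔄 (of hB p).right := of (τ := (of hB p).right) h₂ p₂

/-- Extracting `B` changes no colour or decoration on `A₂`, which is disjoint from it. On `A₁` the
labels of edges leaving `B` are invisible inside `B`, and the node labels of `q.inside` carry them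
instead. -/
theorem left_mul_left (hd : A₂.Disj B) (hB : B ∈ 𝔅.sub τ.c)
    (h₁ : A₁ ∈ 𝔄.sub (τ.c.restrict B)) (h₂ : A₂ ∈ 𝔄.sub (τ.c.cup j B (𝔅.admits hB)))
    (hA : A₂.union (lift A₁) ∈ 𝔄.sub τ.c)
    (q : Labels d (A₂.union (lift A₁))) (q' : Labels d B) :
    (ofLeft hB (q.outer q') h₁ (q.inside hd)).left.mul
      (ofRight hB (q.outer q') h₂ q.outside).left ≈ (of hA q).left := by
  classical
  have hN : ∀ x : A₂.N, x.1 ∉ B.N := fun x => Set.disjoint_left.1 hd x.2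
  have hE : ∀ a : A₂.E, a.1 ∉ B.E := fun a h => hN ⟨_, A₂.src_mem a.1 a.2⟩ (B.src_mem _ h)
  refine ⟨unionLiftIso hd,
    ⟨Sum.forall.2 ⟨fun (x : A₁.N) => ?_, fun (x : A₂.N) => ?_⟩,
      Sum.forall.2 ⟨fun (a : A₁.E) => ?_, fun (a : A₂.E) => ?_⟩⟩,
    Sum.forall.2 ⟨fun (x : A₁.N) => ?_, fun (x : A₂.N) => ?_⟩,
    Sum.forall.2 ⟨fun (x : A₁.N) => ?_, fun (x : A₂.N) => ?_⟩,
    Sum.forall.2 ⟨fun (a : A₁.E) => ?_, fun (a : A₂.E) => ?_⟩⟩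
  · rfl
  · change τ.c.node x.1 = if x.1 ∈ B.N then (j : ℕ) else τ.c.node x.1
    rw [if_neg (hN x)]
  · rfl
  · change τ.c.edge a.1 = if a.1 ∈ B.E then (j : ℕ) else τ.c.edge a.1
    rw [if_neg (hE a)]
  · change q.n x.1.1 + τ.F.push q.ε x.1.1 = q.n x.1.1 + τ.F.push q.crossing x.1.1 +
      B.toForest.push (fun a : B.E => q.ε a.1) x.1
    rw [add_assoc]
    -- The labelled edges from a node of `B` either belong to `B` or cross out of it.
    refine congrArg (q.n x.1.1 + ·) (Eq.trans ?_ (congrArg (τ.F.push q.crossing x.1.1 + ·)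
      (RForest.push_toForest B q.ε x.1).symm))
    refine Eq.trans ?_ (RForest.push_add _ _ _ _)
    refine RForest.push_congr fun a ha => ?_
    have ha' : τ.F.src a ∈ B.N := ha ▸ x.1.2
    unfold Labels.crossing
    by_cases h : a ∈ B.E <;> simp [h, ha']
  · change q.n x.1 + τ.F.push q.ε x.1 = (if x.1 ∈ B.N then 0 else q.n x.1) +
      τ.F.push (fun a => if τ.F.src a ∈ B.N then 0 else q.ε a) x.1
    rw [if_neg (hN x)]
    congr 1
    refine RForest.push_congr fun a ha => ?_
    rw [if_neg (ha ▸ hN x)]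
  · rfl
  · change τ.o x.1 = τ.o x.1 + ((fun k => (((q.outer q').n x.1 k : ℕ) : ℤ)) +
      τ.F.push (of hB (q.outer q')).shift x.1, 0)
    rw [push_shift_eq_zero _ (hN x), (q.outer q').n_eq_zero (hN x)]
    ext <;> simp
  · rfl
  · change τ.e a.1 = (if a.1 ∈ B.E then 0 else τ.e a.1) + (q.outer q').ε a.1
    rw [if_neg (hE a), (q.outer q').ε_eq_zero, add_zero]
    exact fun h => hN ⟨_, A₂.src_mem a.1 a.2⟩ h.2

/-- Both are decorations of the forest `B`, so the identity is the isomorphism. In `𝔫` the crossing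
labels added to `B` are subtracted again with the node labels of `A₁`; in `𝔬` those node labels
replace the contribution of the edges leaving `B`. -/
theorem right_left (hd : A₂.Disj B) (hB : B ∈ 𝔅.sub τ.c)
    (h₁ : A₁ ∈ 𝔄.sub (τ.c.restrict B)) (hA : A₂.union (lift A₁) ∈ 𝔄.sub τ.c)
    (hB' : B ∈ 𝔅.sub (τ.c.cup i _ (𝔄.admits hA)))
    (q : Labels d (A₂.union (lift A₁))) (q' : Labels d B) :
    (ofLeft hB (q.outer q') h₁ (q.inside hd)).right ≈ (ofRight hA q hB' q').left := by
  classical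
  refine ⟨RForest.Iso.refl _, ⟨fun (x : B.N) => ?_, fun (a : B.E) => ?_⟩, fun (x : B.N) => ?_,
    fun (x : B.N) => ?_, fun (a : B.E) => ?_⟩
  · exact if_congr (mem_union_lift_node hd x.2) rfl rfl
  · exact if_congr (mem_union_lift_edge hd a.2) rfl rfl
  · change q'.n x.1 + τ.F.push q'.ε x.1 = (q'.n x.1 + if x.1 ∈ B.N then q.n x.1 else 0) +
      τ.F.push (fun a => q'.ε a + q.crossing a) x.1 - (q.n x.1 + τ.F.push q.crossing x.1)
    have hx : x.1 ∈ B.N := x.2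
    rw [RForest.push_add, if_pos hx, add_add_add_comm, add_tsub_cancel_right]
  · change τ.o x.1 + ((fun k => (q.n x.1 k : ℤ)) + τ.F.push (of hA q).shift x.1, 0) =
      τ.o x.1 + ((fun k => ((q.n x.1 k + τ.F.push q.crossing x.1 k : ℕ) : ℤ)) +
        B.toForest.push (ofLeft hB (q.outer q') h₁ (q.inside hd)).shift x, 0)
    congr 2
    have hs : (ofLeft hB (q.outer q') h₁ (q.inside hd)).shift =
        fun a : B.E => (of hA q).shift a.1 := by
      funext a
      refine (shift_eq _ _ _).trans ((congrArg _ ?_).trans (shift_eq _ _ _).symm)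
      exact if_congr (mem_union_lift_edge hd a.2).symm rfl rfl
    rw [hs, RForest.push_toForest]
    have hc : (fun k => ((q.n x.1 k + τ.F.push q.crossing x.1 k : ℕ) : ℤ)) =
        (fun k => (q.n x.1 k : ℤ)) + τ.F.push (fun a k => (q.crossing a k : ℤ)) x.1 := by
      rw [RForest.push_natCast]
      funext k
      simp
    rw [hc, add_assoc, ← RForest.push_add]
    congr 1
    refine RForest.push_congr fun a ha => ?_
    have ha' : τ.F.src a ∈ B.N := ha ▸ x.2
    rw [shift_eq]
    unfold Labels.crossing
    by_cases h : a ∈ B.E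
    · funext k
      simp [h]
    · funext k
      -- An edge leaving `B` is not in `A`, so no `𝔢` is subtracted there and only the crossing
      -- label remains.
      have h' : a ∉ (A₂.union (lift A₁)).E := fun h' =>
        notMem_edge_of_src hd ha' ((mem_union_lift_edge_of_notMem h).1 h')
      simp [h, h', ha']
  · change (if a.1 ∈ (A₂.union (lift A₁)).E then 0 else τ.e a.1) + q.ε a.1 =
      (if a ∈ A₁.E then 0 else τ.e a.1) + q.ε a.1
    congr 1
    exact if_congr (mem_union_lift_edge hd a.2) rfl rfl

/-- Both colourings are `j` on `B`, `i` on `A₂` and unchanged elsewhere: colour `j` overwrites `A₁`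
in one order. The decorations are compared node by node and edge by edge. -/
theorem right_right (hd : A₂.Disj B) (hB : B ∈ 𝔅.sub τ.c)
    (h₂ : A₂ ∈ 𝔄.sub (τ.c.cup j B (𝔅.admits hB))) (hA : A₂.union (lift A₁) ∈ 𝔄.sub τ.c)
    (hB' : B ∈ 𝔅.sub (τ.c.cup i _ (𝔄.admits hA)))
    (q : Labels d (A₂.union (lift A₁))) (q' : Labels d B) :
    (ofRight hB (q.outer q') h₂ q.outside).right ≈ (ofRight hA q hB' q').right := by
  classical
  have hN : ∀ x ∈ B.N, x ∉ A₂.N := fun x hx h => Set.disjoint_left.1 hd h hx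
  have hE : ∀ a ∈ B.E, a ∉ A₂.E := fun a h h' => notMem_edge_of_src hd (B.src_mem a h) h'
  refine ⟨RForest.Iso.refl _, ⟨fun (x : τ.F.N) => ?_, fun (a : τ.F.E) => ?_⟩,
    fun (x : τ.F.N) => ?_, fun (x : τ.F.N) => ?_, fun (a : τ.F.E) => ?_⟩
  · change (if x ∈ B.N then (j : ℕ) else if x ∈ (A₂.union (lift A₁)).N then i else τ.c.node x) =
      if x ∈ A₂.N then (i : ℕ) else if x ∈ B.N then j else τ.c.node x
    by_cases h : x ∈ B.N
    · simp [h, hN x h]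
    · simp [h, mem_union_lift_node_of_notMem h]
  · change (if a ∈ B.E then (j : ℕ) else if a ∈ (A₂.union (lift A₁)).E then i else τ.c.edge a) =
      if a ∈ A₂.E then (i : ℕ) else if a ∈ B.E then j else τ.c.edge a
    by_cases h : a ∈ B.E
    · simp [h, hE a h]
    · simp [h, mem_union_lift_edge_of_notMem h]
  · change τ.n x - q.n x - q'.n x = τ.n x - (q'.n x + if x ∈ B.N then q.n x else 0) -
      (if x ∈ B.N then 0 else q.n x)
    rw [tsub_tsub, tsub_tsub]
    congr 1
    split_ifs <;> simp [add_comm]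
  · change τ.o x + ((fun k => (q.n x k : ℤ)) + τ.F.push (of hA q).shift x, 0) +
      ((fun k => (q'.n x k : ℤ)) + τ.F.push (ofRight hA q hB' q').shift x, 0) =
      τ.o x + ((fun k => (((q.outer q').n x k : ℕ) : ℤ)) +
        τ.F.push (of hB (q.outer q')).shift x, 0) +
      ((fun k => ((q.outside.n x k : ℕ) : ℤ)) +
        τ.F.push (ofRight hB (q.outer q') h₂ q.outside).shift x, 0)
    refine (add_assoc _ _ _).trans (Eq.trans ?_ (add_assoc _ _ _).symm)
    refine congrArg (τ.o x + ·) (Prod.ext ?_ rfl)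
    refine (add_add_add_comm _ _ _ _).trans (Eq.trans ?_ (add_add_add_comm _ _ _ _))
    rw [← RForest.push_add, ← RForest.push_add]
    congr 1
    · funext k
      simp only [Labels.outer, Labels.outside, Pi.add_apply]
      split_ifs <;> simp [add_comm]
    · refine RForest.push_congr fun a ha => ?_
      have h1 := shift_eq hA q a
      have h2 := shift_eq (τ := (of hA q).right) hB' q' a
      have h3 := shift_eq hB (q.outer q') a
      have h4 := shift_eq (τ := (of hB (q.outer q')).right) h₂ q.outside a
      refine (congrArg₂ (· + ·) h1 h2).trans (Eq.trans ?_ (congrArg₂ (· + ·) h3 h4).symm)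
      funext k
      simp only [Pi.add_apply, Pi.sub_apply]
      -- On an edge of `B` outside `A`, the label of `q` enters `𝔬` with `A` and is removed with
      -- `B`, leaving `-𝔢`. On an edge of `A₁`, `𝔢` is subtracted once in either order. On a
      -- crossing edge the labels of `q` and `q'` add up.
      by_cases hs : τ.F.src a ∈ B.N
      · have ha2 : a ∉ A₂.E := notMem_edge_of_src hd hs
        by_cases h : a ∈ B.E
        · by_cases h' : a ∈ (A₂.union (lift A₁)).E
          · simp [h, h', hs, ha2, Labels.outer, Labels.outside, Labels.crossing,
              q'.ε_eq_zero fun h' => h'.1 h, q.ε_eq_zero fun h'' => h''.1 h']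
          · simp [h, h', hs, ha2, Labels.outer, Labels.outside, Labels.crossing,
              q'.ε_eq_zero fun h' => h'.1 h]
        · have h' : a ∉ (A₂.union (lift A₁)).E :=
            fun h' => ha2 ((mem_union_lift_edge_of_notMem h).1 h')
          simp [h, h', hs, ha2, Labels.outer, Labels.outside, Labels.crossing, add_comm]
      · have h : a ∉ B.E := fun h => hs (B.src_mem a h)
        simp [h, hs, mem_union_lift_edge_of_notMem h, Labels.outer, Labels.outside,
          Labels.crossing, q'.ε_eq_zero fun h' => hs h'.2]
  · change (if a ∈ B.E then 0 else (if a ∈ (A₂.union (lift A₁)).E then 0 else τ.e a) + q.ε a) +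
        q'.ε a = (if a ∈ A₂.E then 0 else (if a ∈ B.E then 0 else τ.e a) +
          (q'.ε a + q.crossing a)) + (if τ.F.src a ∈ B.N then 0 else q.ε a)
    by_cases hs : τ.F.src a ∈ B.N
    · have ha2 : a ∉ A₂.E := notMem_edge_of_src hd hs
      by_cases h : a ∈ B.E
      · simp [h, hs, ha2, Labels.crossing]
      · have h' : a ∉ (A₂.union (lift A₁)).E :=
          fun h' => ha2 ((mem_union_lift_edge_of_notMem h).1 h')
        simp [h, h', hs, ha2, Labels.crossing]
        abel
    · have h : a ∉ B.E := fun h => hs (B.src_mem a h)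
      simp [h, hs, mem_union_lift_edge_of_notMem h, Labels.crossing, q'.ε_eq_zero fun h' => hs h'.2]

end CoprodIndex

/-! ### Comparison of the coefficients -/

theorem Nat.inv_factorial_mul_inv_factorial (a b : ℕ) :
    (1 / (a.factorial : ℝ)) * (1 / b.factorial) =
      1 / ((b + a).factorial : ℝ) * ((b + a).choose a : ℝ) := by
  have h := Nat.add_choose_mul_factorial_mul_factorial b a
  have h1 : ((b + a).factorial : ℝ) ≠ 0 := by positivity
  have h2 : (a.factorial : ℝ) ≠ 0 := by positivity
  have h3 : (b.factorial : ℝ) ≠ 0 := by positivity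
  have h' : ((b + a).choose a : ℝ) * b.factorial * a.factorial = (b + a).factorial := by
    exact_mod_cast h
  field_simp
  linarith

theorem Nat.choose_mul_choose_sub (n a b : ℕ) :
    n.choose a * (n - a).choose b = n.choose (b + a) * (b + a).choose a := by
  have h := Nat.choose_mul (n := n) (k := b + a) (s := a) (by omega)
  rw [h]
  simp

namespace CoprodIndex

open Subforest

variable {L : Type*} {d : ℕ} {i j : ℕ+} {𝔄 : AdmissibleFamily L i} {𝔅 : AdmissibleFamily L j}
  {τ : PreDecorated L d} {B A₂ : Subforest τ.F} {A₁ : Subforest B.toForest}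

/-- The part of the coefficient of a term of `(Δᵢ ⊗ Δᵢ) Δⱼ` without the binomial coefficient
of the left factor. -/
noncomputable def outerCoef (p : Labels d B) (p₁ : Labels d A₁) (p₂ : Labels d A₂) : ℝ :=
  ((∏ a, ∏ k, 1 / ((p.ε a k).factorial : ℝ)) *
    (∏ a, ∏ k, 1 / ((Function.extend Subtype.val p₁.ε 0 a k : ℕ).factorial : ℝ)) *
    ∏ a, ∏ k, 1 / ((p₂.ε a k).factorial : ℝ)) *
  ((∏ x, ∏ k, ((τ.n x k).choose (p.n x k) : ℝ)) *
    ∏ x, ∏ k, ((τ.n x k - p.n x k).choose (p₂.n x k) : ℝ))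

/-- A summand in the Vandermonde expansion of the binomial coefficient of the left factor. -/
noncomputable def crossingCoef (p : Labels d B) (p₁ : Labels d A₁) (g : τ.F.E → Fin d → ℕ) : ℕ :=
  (∏ a, ∏ k, (p.ε a k).choose (g a k)) *
    ∏ x, ∏ k, chooseSub (p.n x k) (Function.extend Subtype.val p₁.n 0 x k) (τ.F.push g x k)

theorem coef_of {A : Subforest τ.F} (hA : A ∈ 𝔄.sub τ.c) (p : Labels d A) :
    (of hA p).coef = (∏ a, ∏ k, 1 / ((p.ε a k).factorial : ℝ)) *
      ∏ x, ∏ k, ((τ.n x k).choose (p.n x k) : ℝ) := by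
  unfold coef
  simp only [one_div, Finset.prod_inv_distrib]

theorem coef_ofLeft (hB : B ∈ 𝔅.sub τ.c) (p : Labels d B) (h₁ : A₁ ∈ 𝔄.sub (τ.c.restrict B))
    (p₁ : Labels d A₁) : (ofLeft hB p h₁ p₁).coef =
      (∏ a, ∏ k, 1 / ((Function.extend Subtype.val p₁.ε 0 a k : ℕ).factorial : ℝ)) *
      ((∏ x, ∏ k, (p.n x k + τ.F.push p.ε x k).choose
        (Function.extend Subtype.val p₁.n 0 x k) : ℕ) : ℝ) := by
  refine (coef_of _ _).trans (congrArg₂ (· * ·) ?_ ?_)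
  · exact @Fintype.prod_extend _ _ _ _ _ _ B.E B.toForest.fE p₁.ε
      (fun _ f => ∏ k, 1 / ((f k).factorial : ℝ)) (by simp)
  · push_cast
    exact @Fintype.prod_extend _ _ _ _ _ _ B.N B.toForest.fN p₁.n
      (fun x f => ∏ k, (((p.n x k + τ.F.push p.ε x k).choose (f k) : ℕ) : ℝ)) (by simp)

/-- The node labels on the extracted forest `B` are `𝔫_B + πε_B`, so the binomial of the second
extraction expands by Vandermonde. This introduces the extra summation variable `g`. -/
theorem coef_mul_coef_mul_coef (hB : B ∈ 𝔅.sub τ.c) (p : Labels d B)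
    (h₁ : A₁ ∈ 𝔄.sub (τ.c.restrict B)) (p₁ : Labels d A₁)
    (h₂ : A₂ ∈ 𝔄.sub (τ.c.cup j B (𝔅.admits hB))) (p₂ : Labels d A₂) :
    ENNReal.ofReal (of hB p).coef * (ENNReal.ofReal (ofLeft hB p h₁ p₁).coef *
      ENNReal.ofReal (ofRight hB p h₂ p₂).coef) =
    ∑' g, ENNReal.ofReal (outerCoef p p₁ p₂) * (crossingCoef p p₁ g : ENNReal) := by
  have h0 : 0 ≤ outerCoef p p₁ p₂ := by
    unfold outerCoef
    positivity
  have hV := RForest.tsum_vandermonde_push τ.F p.ε p.n (Function.extend Subtype.val p₁.n 0)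
  rw [ENNReal.tsum_mul_left]
  unfold crossingCoef
  rw [← hV, ← ENNReal.ofReal_natCast, ← ENNReal.ofReal_mul h0,
    ← ENNReal.ofReal_mul (coef_nonneg _), ← ENNReal.ofReal_mul (coef_nonneg _), coef_of,
    coef_ofLeft]
  refine congrArg ENNReal.ofReal ?_
  have h2 : (ofRight hB p h₂ p₂).coef = (∏ a, ∏ k, 1 / ((p₂.ε a k).factorial : ℝ)) *
      ∏ x, ∏ k, ((τ.n x k - p.n x k).choose (p₂.n x k) : ℝ) := coef_of _ _
  rw [h2]
  unfold outerCoef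
  ring

theorem coef_mul_coef (hd : A₂.Disj B) (hA : A₂.union (lift A₁) ∈ 𝔄.sub τ.c)
    (hB' : B ∈ 𝔅.sub (τ.c.cup i _ (𝔄.admits hA)))
    (q : Labels d (A₂.union (lift A₁))) (q' : Labels d B) :
    ENNReal.ofReal (of hA q).coef * ENNReal.ofReal (ofRight hA q hB' q').coef =
    ENNReal.ofReal (outerCoef (q.outer q') (q.inside hd) q.outside) *
      (crossingCoef (q.outer q') (q.inside hd) q.crossing : ENNReal) := by
  classical
  have h0 : 0 ≤ outerCoef (q.outer q') (q.inside hd) q.outside := by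
    unfold outerCoef
    positivity
  rw [← ENNReal.ofReal_natCast, ← ENNReal.ofReal_mul h0, ← ENNReal.ofReal_mul (coef_nonneg _)]
  refine congrArg ENNReal.ofReal ?_
  have h2 : (ofRight hA q hB' q').coef = (∏ a, ∏ k, 1 / ((q'.ε a k).factorial : ℝ)) *
      ∏ x, ∏ k, ((τ.n x k - q.n x k).choose (q'.n x k) : ℝ) := coef_of _ _
  rw [h2, coef_of, mul_mul_mul_comm]
  unfold outerCoef crossingCoef
  push_cast
  refine Eq.trans ?_ (mul_mul_mul_comm _ _ _ _)
  simp only [← Finset.prod_mul_distrib]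
  refine congrArg₂ (· * ·) (Finset.prod_congr rfl fun a _ => Finset.prod_congr rfl fun k _ => ?_)
    (Finset.prod_congr rfl fun x _ => Finset.prod_congr rfl fun k _ => ?_)
  -- The factorial of `q.ε a` comes from `A₁` on edges of `B`, from splitting the label of `p` on
  -- crossing edges, and from `A₂` on edges starting outside `B`.
  · by_cases h : a ∈ B.E
    · have hs : τ.F.src a ∈ B.N := B.src_mem a h
      have he : Function.extend Subtype.val (q.inside hd).ε 0 a = q.ε a :=
        Subtype.val_injective.extend_apply (q.inside hd).ε 0 (⟨a, h⟩ : B.E)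
      simp [he, Labels.outer, Labels.outside, Labels.crossing, h, hs,
        q'.ε_eq_zero fun h' => h'.1 h]
    · have he : Function.extend Subtype.val (q.inside hd).ε 0 a = 0 :=
        Function.extend_apply' _ _ _ (by simpa using h)
      rw [he]
      by_cases hs : τ.F.src a ∈ B.N
      · have := Nat.inv_factorial_mul_inv_factorial (q.ε a k) (q'.ε a k)
        simpa [Labels.outer, Labels.outside, Labels.crossing, h, hs] using this
      · simp [Labels.outer, Labels.outside, Labels.crossing, h, hs,
          q'.ε_eq_zero fun h' => hs h'.2]
  · norm_cast
    by_cases h : x ∈ B.N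
    · have he : Function.extend Subtype.val (q.inside hd).n 0 x = q.n x + τ.F.push q.crossing x :=
        Subtype.val_injective.extend_apply (q.inside hd).n 0 (⟨x, h⟩ : B.N)
      rw [he]
      simp [Labels.outer, Labels.outside, h, chooseSub, Nat.choose_mul_choose_sub]
    · have he : Function.extend Subtype.val (q.inside hd).n 0 x = 0 :=
        Function.extend_apply' _ _ _ (by simpa using h)
      have hc : τ.F.push q.crossing x = 0 :=
        Labels.push_crossing_eq_zero hd q fun ⟨h', _⟩ => h h'
      simp [he, hc, Labels.outer, Labels.outside, h, chooseSub, q'.n_eq_zero h]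

/-- With the subforests fixed, both sides are sums of one function `G`: over all `(p, p₁, p₂, g)` on
the left, along `Labels.split` on the right. -/
theorem tsum_labels_eq (hij : i < j) (hB : B ∈ 𝔅.sub τ.c)
    (h₁ : A₁ ∈ 𝔄.sub (τ.c.restrict B)) (h₂ : A₂ ∈ 𝔄.sub (τ.c.cup j B (𝔅.admits hB)))
    (hA : A₂.union (lift A₁) ∈ 𝔄.sub τ.c) (hB' : B ∈ 𝔅.sub (τ.c.cup i _ (𝔄.admits hA)))
    (w : Decorated L d × (Decorated L d × Decorated L d)) :
    (∑' (p : Labels d B) (p₁ : Labels d A₁) (p₂ : Labels d A₂), ENNReal.ofReal (of hB p).coef *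
      (ENNReal.ofReal (ofLeft hB p h₁ p₁).coef * (ENNReal.ofReal (ofRight hB p h₂ p₂).coef *
        (mul1324 L d).ecoeff ((ofLeft hB p h₁ p₁).term, (ofRight hB p h₂ p₂).term) w))) =
    ∑' (q : Labels d (A₂.union (lift A₁))) (q' : Labels d B), ENNReal.ofReal (of hA q).coef *
      (ENNReal.ofReal (ofRight hA q hB' q').coef *
        Tri.one.ecoeff (Decorated.mk (of hA q).left, (ofRight hA q hB' q').term) w) := by
  have hd : A₂.Disj B := AdmissibleFamily.disj_of_mem_cup hij (𝔅.admits hB) h₂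
  let G : Labels d B × Labels d A₁ × Labels d A₂ × (τ.F.E → Fin d → ℕ) → ENNReal := fun z =>
    ENNReal.ofReal (outerCoef z.1 z.2.1 z.2.2.1) * (crossingCoef z.1 z.2.1 z.2.2.2 : ENNReal) *
      (mul1324 L d).ecoeff ((ofLeft hB z.1 h₁ z.2.1).term, (ofRight hB z.1 h₂ z.2.2.1).term) w
  have hl : ∀ p p₁ p₂, ENNReal.ofReal (of hB p).coef *
      (ENNReal.ofReal (ofLeft hB p h₁ p₁).coef * (ENNReal.ofReal (ofRight hB p h₂ p₂).coef *
        (mul1324 L d).ecoeff ((ofLeft hB p h₁ p₁).term, (ofRight hB p h₂ p₂).term) w)) =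
      ∑' g, G (p, p₁, p₂, g) := by
    intro p p₁ p₂
    rw [← mul_assoc, ← mul_assoc, mul_assoc (ENNReal.ofReal (of hB p).coef),
      coef_mul_coef_mul_coef hB p h₁ p₁ h₂ p₂]
    exact ENNReal.tsum_mul_right.symm
  have hr : ∀ q q', ENNReal.ofReal (of hA q).coef *
      (ENNReal.ofReal (ofRight hA q hB' q').coef *
        Tri.one.ecoeff (Decorated.mk (of hA q).left, (ofRight hA q hB' q').term) w) =
      G (Labels.split hd (q, q')) := by
    intro q q'
    rw [← mul_assoc, coef_mul_coef hd hA hB' q q']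
    change _ = _ * (mul1324 L d).ecoeff ((ofLeft hB (q.outer q') h₁ (q.inside hd)).term,
      (ofRight hB (q.outer q') h₂ q.outside).term) w
    refine congrArg₂ (· * ·) rfl ?_
    have e1 : (Decorated.mk (ofLeft hB (q.outer q') h₁ (q.inside hd)).left).mul
        (Decorated.mk (ofRight hB (q.outer q') h₂ q.outside).left) =
        Decorated.mk (of hA q).left := Quotient.sound (left_mul_left hd hB h₁ h₂ hA q q')
    have e2 : Decorated.mk (ofLeft hB (q.outer q') h₁ (q.inside hd)).right =
      Decorated.mk (ofRight hA q hB' q').left := Quotient.sound (right_left hd hB h₁ hA hB' q q')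
    have e3 : Decorated.mk (ofRight hB (q.outer q') h₂ q.outside).right =
      Decorated.mk (ofRight hA q hB' q').right := Quotient.sound (right_right hd hB h₂ hA hB' q q')
    exact Tri.ecoeff_ofMap_congr _ _ (Prod.ext e1.symm (Prod.ext e2.symm e3.symm)) w
  simp_rw [hl, hr]
  rw [← ENNReal.tsum_prod (f := fun q q' => G (Labels.split hd (q, q')))]
  have hG : ∑' (p) (p₁) (p₂) (g), G (p, p₁, p₂, g) = ∑' z, G z := by
    simp only [ENNReal.tsum_prod']
  refine Eq.trans hG (Eq.symm ?_)
  -- It remains to see that `G` is supported in the range of `split`: a nonzero Vandermonde summand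
  -- forces exactly the inequalities of `mem_range_split`.
  refine (Labels.split_injective hd).tsum_eq (f := G) fun z hz => ?_
  obtain ⟨p, p₁, p₂, g⟩ := z
  have h0 : crossingCoef p p₁ g ≠ 0 := by
    intro h0
    exact hz (by simp [G, h0])
  obtain ⟨h3, h4⟩ := mul_ne_zero_iff.1 h0
  simp only [Finset.prod_ne_zero_iff, Finset.mem_univ, true_implies] at h3 h4
  have h5 : ∀ x k, τ.F.push g x k ≤ Function.extend Subtype.val p₁.n 0 x k := by
    intro x k
    by_contra hc
    exact h4 x k (if_neg hc)
  refine Labels.mem_range_split hd p p₁ p₂ g (fun a k => ?_) h5 fun x k => ?_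
  · by_contra hc
    exact h3 a k (Nat.choose_eq_zero_of_lt (not_le.1 hc))
  · by_contra hc
    refine h4 x k ((if_pos (h5 x k)).trans (Nat.choose_eq_zero_of_lt ?_))
    have := h5 x k
    simp only [Pi.add_apply, not_le] at hc
    omega

end CoprodIndex

/-! ### Correspondence of subforests and conclusion -/

section

open Subforest

variable {L : Type*} {d : ℕ} {i j : ℕ+} {𝔄 : AdmissibleFamily L i} {𝔅 : AdmissibleFamily L j}

/-- The correspondence between the subforests in the sums for `(Δᵢ ⊗ Δᵢ) Δⱼ` and
`(id ⊗ Δⱼ) Δᵢ`. -/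
noncomputable def AdmissibleFamily.Cointeract.equiv (h : 𝔄.Cointeract 𝔅) (hij : i < j)
    {F : RForest L} (c : Colouring F) :
    (Σ B : {B : Subforest F // B ∈ 𝔅.sub c}, {A₁ : Subforest B.1.toForest // A₁ ∈
      𝔄.sub (c.restrict B.1)} × {A₂ : Subforest F // A₂ ∈ 𝔄.sub (c.cup j B.1 (𝔅.admits B.2))}) ≃
    Σ A : {A : Subforest F // A ∈ 𝔄.sub c},
      {B : Subforest F // B ∈ 𝔅.sub (c.cup i A.1 (𝔄.admits A.2))} := by
  have key : ∀ z : (Σ B : {B : Subforest F // B ∈ 𝔅.sub c}, {A₁ : Subforest B.1.toForest // A₁ ∈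
      𝔄.sub (c.restrict B.1)} × {A₂ : Subforest F // A₂ ∈ 𝔄.sub (c.cup j B.1 (𝔅.admits B.2))}),
      ∃ hA : z.2.2.1.union (lift z.2.1.1) ∈ 𝔄.sub c, z.1.1 ∈ 𝔅.sub (c.cup i _ (𝔄.admits hA)) :=
    fun z => (h F c _ z.1.1).2 ⟨z.1.2, z.2.2.1, z.2.2.2, z.2.1.1, z.2.1.2, rfl⟩
  refine Equiv.ofBijective
    (fun z => ⟨⟨z.2.2.1.union (lift z.2.1.1), (key z).1⟩, ⟨z.1.1, (key z).2⟩⟩) ⟨?_, ?_⟩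
  · rintro ⟨⟨B, hB⟩, ⟨A₁, h₁⟩, ⟨A₂, h₂⟩⟩ ⟨⟨B', hB'⟩, ⟨A₁', h₁'⟩, ⟨A₂', h₂'⟩⟩ hz
    have e1 : A₂.union (lift A₁) = A₂'.union (lift A₁') := congrArg (fun z => z.1.1) hz
    have e2 : B = B' := congrArg (fun z => z.2.1) hz
    subst e2
    -- With the same `B` on both sides, the decomposition of `A` into its parts inside and outside
    -- `B` is unique.
    obtain ⟨rfl, rfl⟩ := eq_of_union_lift_eq (AdmissibleFamily.disj_of_mem_cup hij _ h₂)
      (AdmissibleFamily.disj_of_mem_cup hij _ h₂') e1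
    rfl
  · rintro ⟨⟨A, hA⟩, ⟨B, hB⟩⟩
    obtain ⟨hB', A₂, h₂, A₁, h₁, rfl⟩ := (h F c A B).1 ⟨hA, hB⟩
    exact ⟨⟨⟨B, hB'⟩, ⟨A₁, h₁⟩, ⟨A₂, h₂⟩⟩, rfl⟩

open CoprodIndex in
-- Colourings after an extraction do not depend on the labels, so neither do the families of
-- admissible subforests. All sums over subforests can therefore be moved outside, matched by
-- `h.equiv`, and the label sums compared for each choice.
theorem tsum_coprodIndex_eq (h : 𝔄.Cointeract 𝔅) (hij : i < j) (τ : PreDecorated L d)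
    (w : Decorated L d × (Decorated L d × Decorated L d)) :
    (∑' t : CoprodIndex 𝔅 τ, ENNReal.ofReal t.coef *
      ∑' t₁ : CoprodIndex 𝔄 t.left, ENNReal.ofReal t₁.coef *
      ∑' t₂ : CoprodIndex 𝔄 t.right, ENNReal.ofReal t₂.coef *
        (mul1324 L d).ecoeff (t₁.term, t₂.term) w) =
    ∑' s : CoprodIndex 𝔄 τ, ENNReal.ofReal s.coef *
      ∑' s' : CoprodIndex 𝔅 s.right, ENNReal.ofReal s'.coef *
        Tri.one.ecoeff (Decorated.mk s.left, s'.term) w := by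
  simp_rw [← ENNReal.tsum_mul_left, CoprodIndex.tsum_eq]
  have hl : ∀ B : {B : Subforest τ.F // B ∈ 𝔅.sub τ.c},
      (∑' (p : Labels d B.1)
        (A₁ : {A₁ : Subforest B.1.toForest // A₁ ∈ 𝔄.sub (τ.c.restrict B.1)})
        (p₁ : Labels d A₁.1)
        (A₂ : {A₂ : Subforest τ.F // A₂ ∈ 𝔄.sub (τ.c.cup j B.1 (𝔅.admits B.2))})
        (p₂ : Labels d A₂.1), ENNReal.ofReal (of B.2 p).coef *
        (ENNReal.ofReal (ofLeft B.2 p A₁.2 p₁).coef *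
          (ENNReal.ofReal (ofRight B.2 p A₂.2 p₂).coef *
        (mul1324 L d).ecoeff ((ofLeft B.2 p A₁.2 p₁).term, (ofRight B.2 p A₂.2 p₂).term) w))) =
      ∑' (A₁ : {A₁ : Subforest B.1.toForest // A₁ ∈ 𝔄.sub (τ.c.restrict B.1)})
        (A₂ : {A₂ : Subforest τ.F // A₂ ∈ 𝔄.sub (τ.c.cup j B.1 (𝔅.admits B.2))})
        (p : Labels d B.1) (p₁ : Labels d A₁.1) (p₂ : Labels d A₂.1),
        ENNReal.ofReal (of B.2 p).coef *
        (ENNReal.ofReal (ofLeft B.2 p A₁.2 p₁).coef *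
          (ENNReal.ofReal (ofRight B.2 p A₂.2 p₂).coef *
        (mul1324 L d).ecoeff ((ofLeft B.2 p A₁.2 p₁).term, (ofRight B.2 p A₂.2 p₂).term) w)) := by
    intro B
    rw [ENNReal.tsum_comm]
    refine tsum_congr fun A₁ => ?_
    rw [ENNReal.tsum_comm (α := {A₂ : Subforest τ.F // _})]
    refine tsum_congr fun p => ?_
    rw [ENNReal.tsum_comm]
  have hr : ∀ A : {A : Subforest τ.F // A ∈ 𝔄.sub τ.c},
      (∑' (q : Labels d A.1)
        (B : {B : Subforest τ.F // B ∈ 𝔅.sub (τ.c.cup i A.1 (𝔄.admits A.2))})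
        (q' : Labels d B.1), ENNReal.ofReal (of A.2 q).coef *
        (ENNReal.ofReal (ofRight A.2 q B.2 q').coef *
          Tri.one.ecoeff (Decorated.mk (of A.2 q).left, (ofRight A.2 q B.2 q').term) w)) =
      ∑' (B : {B : Subforest τ.F // B ∈ 𝔅.sub (τ.c.cup i A.1 (𝔄.admits A.2))})
        (q : Labels d A.1)
        (q' : Labels d B.1), ENNReal.ofReal (of A.2 q).coef *
        (ENNReal.ofReal (ofRight A.2 q B.2 q').coef *
          Tri.one.ecoeff (Decorated.mk (of A.2 q).left, (ofRight A.2 q B.2 q').term) w) :=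
    fun A => ENNReal.tsum_comm
  refine (tsum_congr hl).trans (Eq.trans ?_ (tsum_congr hr).symm)
  refine Eq.trans ?_ (((h.equiv hij τ.c).tsum_eq fun z => ∑' (q : Labels d z.1.1)
    (q' : Labels d z.2.1), ENNReal.ofReal (of z.1.2 q).coef *
      (ENNReal.ofReal (ofRight z.1.2 q z.2.2 q').coef * Tri.one.ecoeff
        (Decorated.mk (of z.1.2 q).left, (ofRight z.1.2 q z.2.2 q').term) w)).trans
    (ENNReal.tsum_sigma' _))
  refine Eq.trans (tsum_congr fun B => ?_) (ENNReal.tsum_sigma' _).symm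
  refine Eq.trans (tsum_congr fun A₁ => tsum_congr fun A₂ => ?_) ENNReal.tsum_prod'.symm
  obtain ⟨hA, hB'⟩ := (h τ.F τ.c (A₂.1.union (lift A₁.1)) B.1).2
    ⟨B.2, A₂.1, A₂.2, A₁.1, A₁.2, rfl⟩
  exact tsum_labels_eq hij B.2 A₁.2 A₂.2 hA hB' w

end

theorem proposition3 (L : Type*) [Finite L] (d : ℕ) (i j : ℕ+) (hij : i < j)
    (𝔄 : AdmissibleFamily L i) (𝔅 : AdmissibleFamily L j) (h : 𝔄.Cointeract 𝔅) :
    (mul1324 L d).lin ∘ₗ ((coprod d 𝔄).tensor (coprod d 𝔄)).lin ∘ₗ (coprod d 𝔅).lin =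
      (Tri.one.tensor (coprod d 𝔅)).lin ∘ₗ (coprod d 𝔄).lin := by
  have hA := coprod_nonneg d 𝔄
  have hB := coprod_nonneg d 𝔅
  -- Once both sides are induced by single triangular families, it is enough to compare matrix
  -- entries.
  rw [← Tri.lin_comp, ← Tri.lin_comp, ← Tri.lin_comp]
  refine congrArg Tri.lin (Tri.ext_ecoeff
    (Tri.Nonneg.comp (Tri.nonneg_ofMap _ _) ((hA.tensor hA).comp hB))
    (((Tri.nonneg_ofMap _ _).tensor hB).comp hA) fun x w => ?_)
  induction x using Quotient.inductionOn with
  | h τ =>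
    exact (ecoeff_mul_tensor_coprod 𝔄 𝔅 τ w).trans
      ((tsum_coprodIndex_eq h hij τ w).trans (ecoeff_one_tensor_coprod 𝔄 𝔅 τ w).symm)
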